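/- Let $X$ be a complex Hilbert space, $\lambda_1<\lambda_2$ real numbers, $\mathcal U\subset\mathbb C$ an open set containing the segment $[\lambda_1,\lambda_2]\subset\mathbb R$, and $U:\mathcal U\to\mathcal B(X)$ an analytic function. Suppose that $I+U(\lambda_1)$ and $I+U(\lambda_2)$ are invertible and that, for all $\lambda\in\mathcal U$, (i) $I+U(\lambda)$ is Fredholm; (ii) $U(\lambda)$ is unitary if $\lambda\in\mathbb R$; (iii) $\sigma(U(\lambda))\subset\{z:|z|>1\}$ if $\operatorname{Im}\lambda>0$; (iv) $\sigma(U(\lambda))\subset\{z:|z|<1\}$ if $\operatorname{Im}\lambda<0$. Then $\ker(I+U(\lambda))$ is finite-dimensional for every $\lambda\in(\lambda_1,\lambda_2)$ and nonzero for only finitely many such $\lambda$, the spectral flow of $U|_{[\lambda_1,\lambda_2]}$ through $-1$ is well defined, and $$\operatorname{sf}\big(U|_{\lambda_1}^{\lambda_2},-1\big)=-\sum_{\lambda_1<\lambda<\lambda_2}\dim\ker\big(I+U(\lambda)\big).$$ Here the spectral flow (counted positively in the counterclockwise direction) is defined as follows. Choose a subdivision $\lambda_1=t_0<t_1<\dots<t_n=\lambda_2$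 and numbers $\varepsilon_1,\dots,\varepsilon_n\in(0,\pi)$ such that, for each $j$ and all $t\in[t_{j-1},t_j]$, the points $e^{i(\pi\pm\varepsilon_j)}$ do not lie in $\sigma(U(t))$ and the arc $\{e^{i(\pi+\theta)}:|\theta|\le\varepsilon_j\}$ contains only finitely many points of $\sigma(U(t))$, all with finite-dimensional eigenspaces. Then $$\operatorname{sf}\big(U|_{\lambda_1}^{\lambda_2},-1\big)=\sum_{j=1}^n\big(k(t_j,\varepsilon_j)-k(t_{j-1},\varepsilon_j)\big),\qquad k(t,\varepsilon)=\sum_{0\le\theta\le\varepsilon}\dim\ker\big(U(t)-e^{i(\pi+\theta)}\big).$$ That the spectral flow is well defined means that such a choice exists and that the number obtained does not depend on the choice. -/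

import Mathlib

noncomputable section

namespace AbstractSF

variable {X : Type*} [NormedAddCommGroup X] [InnerProductSpace ℂ X]

/-- The point `e^{i(π + θ)}` of the unit circle, at signed counterclockwise angle `θ` from `-1`. -/
def circlePt (θ : ℝ) : ℂ := Complex.exp ((Real.pi + θ : ℝ) * Complex.I)

/-- `k(T, ε) = ∑_{0 ≤ θ ≤ ε} dim ker (T - e^{i(π + θ)})`. It is only used when the eigenvalues of
`T` in this arc are finite in number and of finite multiplicity. -/
def arcCount (T : X →L[ℂ] X) (ε : ℝ) : ℕ :=
  ∑ᶠ θ ∈ Set.Icc (0 : ℝ) ε,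
    Module.finrank ℂ (LinearMap.ker ((T - circlePt θ • 1 : X →L[ℂ] X) : X →ₗ[ℂ] X))

/-- The data used to define the spectral flow through `-1` of a path `W` of unitary operators
on `[a, b]`: a subdivision `a = t 0 < t 1 < ⋯ < t n = b` and numbers `0 < ε i < π` such that for
all `s ∈ [t i, t (i + 1)]` the points `e^{i(π ± ε i)}` are not in `σ(W s)`, and in the arc
`{e^{i(π + θ)} : |θ| ≤ ε i}` the operator `W s` has only finitely many spectral points, each with
a finite-dimensional eigenspace. (Such points are isolated in the spectrum of the unitary
operator `W s`, hence are eigenvalues of finite multiplicity.) -/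
structure FlowPartition (W : ℝ → X →L[ℂ] X) (a b : ℝ) where
  n : ℕ
  t : ℕ → ℝ
  ε : ℕ → ℝ
  t_zero : t 0 = a
  t_last : t n = b
  t_lt : ∀ i < n, t i < t (i + 1)
  ε_pos : ∀ i < n, 0 < ε i
  ε_lt : ∀ i < n, ε i < Real.pi
  notMem_right : ∀ i < n, ∀ s ∈ Set.Icc (t i) (t (i + 1)), circlePt (ε i) ∉ spectrum ℂ (W s)
  notMem_left : ∀ i < n, ∀ s ∈ Set.Icc (t i) (t (i + 1)), circlePt (-ε i) ∉ spectrum ℂ (W s)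
  finite_spectrum : ∀ i < n, ∀ s ∈ Set.Icc (t i) (t (i + 1)),
    {θ ∈ Set.Icc (-ε i) (ε i) | circlePt θ ∈ spectrum ℂ (W s)}.Finite
  finite_mult : ∀ i < n, ∀ s ∈ Set.Icc (t i) (t (i + 1)), ∀ θ ∈ Set.Icc (-ε i) (ε i),
    FiniteDimensional ℂ
      (LinearMap.ker ((W s - circlePt θ • 1 : X →L[ℂ] X) : X →ₗ[ℂ] X))

/-- The spectral flow computed from a given subdivision:
`∑ᵢ (k(W (t (i + 1)), ε i) - k(W (t i), ε i))`. -/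
def FlowPartition.flow {W : ℝ → X →L[ℂ] X} {a b : ℝ} (P : FlowPartition W a b) : ℤ :=
  ∑ i ∈ Finset.range P.n,
    ((arcCount (W (P.t (i + 1))) (P.ε i) : ℤ) - (arcCount (W (P.t i)) (P.ε i) : ℤ))

/-- `sf(W|_a^b, -1) = m`: the spectral flow of `W` through `-1` on `[a, b]`, counted positively in
the counterclockwise direction, is well defined (an admissible subdivision exists, and all
admissible subdivisions give the same number), and its value is `m`. -/
def HasSpectralFlow (W : ℝ → X →L[ℂ] X) (a b : ℝ) (m : ℤ) : Prop :=
  Nonempty (FlowPartition W a b) ∧ ∀ P : FlowPartition W a b, P.flow = m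

end AbstractSF

end

set_option linter.unusedSectionVars false

/-! ### Spectral projections of normal operators for discs -/

noncomputable section

namespace AbstractSF

open Metric Set Filter Topology

variable {X : Type*} [NormedAddCommGroup X] [InnerProductSpace ℂ X]

/-! The point is that eigenvalues of `U t` on the unit circle can only move clockwise as `t`
increases. Let `w` be an isolated eigenvalue of `U s` of finite multiplicity with eigenspace `E`.
Differentiating `⟪U t x, U t y⟫ = ⟪x, y⟫` shows that the compression of `conj w • U'(s)` to `E` is
skew-adjoint. If it had an eigenvalue `i h` with `h > 0`, then `U (s + iη)` would have spectrum near
`w (1 - η h)`, inside the unit disc, against the hypothesis on the upper half plane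
(`im_inner_deriv_nonpos`). Hence the angles of nearby eigenvalues have nonpositive Dini derivatives
(`exists_angle_mul_lt_of_eigenvector`). A compactness argument turns this into a statement about the
spectrum as a closed set in the plane of times and angles (`notMem_of_moves_clockwise`), so that no
branches of eigenvalues need be chosen.

Since `1 + U s` is Fredholm, `-1` is at most an isolated eigenvalue of finite multiplicity.
Eigenvalues near `-1` therefore lie on the clockwise side just after `s` and on the counterclockwise
side just before `s`. They might still rest at `-1`; this is excluded by analyticity. The
singularity of `1 + U z` near `s` is the vanishing of an analytic finite determinant, which is not
identically zero because `-1` is off the spectrum for `Im z > 0`. So `-1` is an eigenvalue only at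
isolated times.

The ranks of spectral projections are locally constant (`exists_finrank_discProj_eq`). Consequently
`k(t, ε)`, which counts `-1` itself and the counterclockwise arc, is left-continuous and drops by
`dim ker (1 + U s)` right after `s`. Adding the multiplicities over `[a, t)` gives a locally
constant, hence constant, function of `t`; this is `arcCount_add_finsum`. Summation over any
admissible subdivision telescopes to the same value, and invertibility at `λ₁` removes the left end
point. -/

theorem continuousOn_ite_dist {σ : Set ℂ} {c : ℂ} {r : ℝ} (h : ∀ z ∈ σ, dist z c ≠ r)
    {f g : ℂ → ℂ} (hf : ContinuousOn f (ball c r)) (hg : ContinuousOn g (closedBall c r)ᶜ) :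
    ContinuousOn (fun z => if dist z c ≤ r then f z else g z) σ := by
  intro z hz
  apply ContinuousAt.continuousWithinAt
  rcases lt_or_gt_of_ne (h z hz) with hlt | hgt
  · refine (hf.continuousAt (isOpen_ball.mem_nhds hlt)).congr ?_
    filter_upwards [isOpen_ball.mem_nhds (mem_ball.2 hlt)] with y hy
    rw [if_pos (mem_ball.1 hy).le]
  · have hz' : z ∈ (closedBall c r)ᶜ := by simpa using hgt
    refine (hg.continuousAt (isClosed_closedBall.isOpen_compl.mem_nhds hz')).congr ?_
    filter_upwards [isClosed_closedBall.isOpen_compl.mem_nhds hz'] with y hy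
    rw [if_neg (by simpa using hy)]

/-- The spectral projection of a normal operator `T` for the disc of centre `c` and radius `r`,
meaningful when the bounding circle does not meet the spectrum. -/
def discProj [CompleteSpace X] (T : X →L[ℂ] X) (c : ℂ) (r : ℝ) : X →L[ℂ] X :=
  cfc (fun z => if dist z c ≤ r then (1 : ℂ) else 0) T

/-- The inverse of `T - w` on the spectral subspace of a normal operator `T` complementary to the
disc of centre `c` and radius `r`, extended by zero. -/
def discInv [CompleteSpace X] (T : X →L[ℂ] X) (c : ℂ) (r : ℝ) (w : ℂ) : X →L[ℂ] X :=
  cfc (fun z => if dist z c ≤ r then (0 : ℂ) else (z - w)⁻¹) T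

section Normal

variable [CompleteSpace X] {T : X →L[ℂ] X} [hT : IsStarNormal T] {c w : ℂ} {r : ℝ}

theorem continuousOn_proj_fun {σ : Set ℂ} (h : ∀ z ∈ σ, dist z c ≠ r) :
    ContinuousOn (fun z => if dist z c ≤ r then (1 : ℂ) else 0) σ :=
  continuousOn_ite_dist h continuousOn_const continuousOn_const

theorem continuousOn_inv_fun {σ : Set ℂ} (h : ∀ z ∈ σ, dist z c ≠ r) (hw : dist w c ≤ r) :
    ContinuousOn (fun z => if dist z c ≤ r then (0 : ℂ) else (z - w)⁻¹) σ := by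
  refine continuousOn_ite_dist h continuousOn_const
    (ContinuousOn.inv₀ (by fun_prop) fun z hz h0 => hz ?_)
  rw [sub_eq_zero.1 h0]
  exact hw

theorem sub_smul_one_eq_cfc (w : ℂ) : T - w • (1 : X →L[ℂ] X) = cfc (fun z => z - w) T := by
  rw [cfc_sub (fun z => z) (fun _ => w) T, cfc_id' ℂ T, cfc_const w T, Algebra.algebraMap_eq_smul_one]

theorem discProj_mul_self (h : ∀ z ∈ spectrum ℂ T, dist z c ≠ r) :
    discProj T c r * discProj T c r = discProj T c r := by
  have hc := continuousOn_proj_fun h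
  rw [discProj, ← cfc_mul _ _ T hc hc]
  congr 1
  ext z
  split_ifs <;> simp

theorem star_discProj : star (discProj T c r) = discProj T c r := by
  rw [discProj, ← cfc_star]
  congr 1
  ext z
  split_ifs <;> simp

/-- Compare symbols: inside the disc both sides vanish, outside both are 1. The pole `w` lies in the
closed disc, where the symbol of `discInv` is 0. -/
theorem discInv_mul_sub (h : ∀ z ∈ spectrum ℂ T, dist z c ≠ r) (hw : dist w c ≤ r) :
    discInv T c r w * (T - w • 1) = 1 - discProj T c r := by
  have hc := continuousOn_proj_fun h
  have hi := continuousOn_inv_fun h hw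
  rw [sub_smul_one_eq_cfc, discInv, discProj, ← cfc_mul _ _ T hi (by fun_prop), ← cfc_one ℂ T,
    ← cfc_sub _ _ T (by fun_prop) hc]
  congr 1
  ext z
  by_cases hz : dist z c ≤ r
  · simp [hz]
  · have : z - w ≠ 0 := fun h0 => hz (by rw [sub_eq_zero.1 h0]; exact hw)
    simp [hz, this]

theorem commute_discProj_sub : Commute (discProj T c r) (T - w • 1) := by
  rw [sub_smul_one_eq_cfc]
  exact cfc_commute_cfc _ _ _

theorem commute_discInv_sub : Commute (discInv T c r w) (T - w • 1) := by
  rw [sub_smul_one_eq_cfc]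
  exact cfc_commute_cfc _ _ _

theorem sub_mul_discInv (h : ∀ z ∈ spectrum ℂ T, dist z c ≠ r) (hw : dist w c ≤ r) :
    (T - w • 1) * discInv T c r w = 1 - discProj T c r := by
  rw [← commute_discInv_sub.eq, discInv_mul_sub h hw]

theorem exists_gap_of_sphere (h : ∀ z ∈ spectrum ℂ T, dist z c ≠ r) :
    ∃ η > 0, ∀ z ∈ spectrum ℂ T, η ≤ |dist z c - r| := by
  have hK : IsCompact (spectrum ℂ T) := spectrum.isCompact T
  rcases (spectrum ℂ T).eq_empty_or_nonempty with he | hne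
  · exact ⟨1, one_pos, by simp [he]⟩
  · obtain ⟨z₀, hz₀, hmin⟩ := hK.exists_isMinOn hne
      (f := fun z => |dist z c - r|) (by fun_prop)
    exact ⟨|dist z₀ c - r|, abs_pos.2 (sub_ne_zero.2 (h z₀ hz₀)), fun z hz => hmin hz⟩

/-- The symbol of `(T - c) * discProj` is `z - c` cut off to the disc. Together with the opposite
bound on the kernel of the projection, this distinguishes the two subspaces by the size of `T - c`
alone, a quantity stable under perturbation. -/
theorem norm_sub_le_of_discProj (h : ∀ z ∈ spectrum ℂ T, dist z c ≠ r) {ρ : ℝ} (hρ : 0 ≤ ρ)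
    (hσ : ∀ z ∈ spectrum ℂ T, dist z c ≤ r → dist z c ≤ ρ) {x : X} (hx : discProj T c r x = x) :
    ‖(T - c • 1) x‖ ≤ ρ * ‖x‖ := by
  have hc := continuousOn_proj_fun h
  have hb : ‖(T - c • 1) * discProj T c r‖ ≤ ρ := by
    rw [sub_smul_one_eq_cfc, discProj, ← cfc_mul _ _ T (by fun_prop) hc]
    refine norm_cfc_le hρ fun z hz => ?_
    by_cases hzr : dist z c ≤ r
    · simpa [hzr, ← dist_eq_norm] using hσ z hz hzr
    · simpa [hzr] using hρ
  calc ‖(T - c • 1) x‖ = ‖((T - c • 1) * discProj T c r) x‖ := by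
        rw [mul_apply_eq_comp, hx]
    _ ≤ ρ * ‖x‖ := ContinuousLinearMap.le_of_opNorm_le _ hb x

theorem le_norm_sub_of_discProj (h : ∀ z ∈ spectrum ℂ T, dist z c ≠ r) (hr : 0 ≤ r) {ρ : ℝ}
    (hρ : 0 < ρ) (hσ : ∀ z ∈ spectrum ℂ T, r < dist z c → ρ ≤ dist z c) {x : X}
    (hx : discProj T c r x = 0) : ρ * ‖x‖ ≤ ‖(T - c • 1) x‖ := by
  have hb : ‖discInv T c r c‖ ≤ ρ⁻¹ := by
    rw [discInv]
    refine norm_cfc_le (by positivity) fun z hz => ?_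
    by_cases hzr : dist z c ≤ r
    · simp [hzr, hρ.le]
    · have := hσ z hz (not_le.1 hzr)
      simp only [hzr, if_false, norm_inv, ← dist_eq_norm]
      exact inv_anti₀ hρ this
  have hx' : discInv T c r c ((T - c • 1) x) = x := by
    rw [← mul_apply_eq_comp, discInv_mul_sub h (by simpa using hr)]
    simp [hx]
  have := ContinuousLinearMap.le_of_opNorm_le _ hb ((T - c • 1) x)
  rw [hx', inv_mul_eq_div, le_div_iff₀ hρ] at this
  linarith

end Normal

variable [CompleteSpace X]

theorem mem_range_discProj {T : X →L[ℂ] X} [IsStarNormal T] {c : ℂ} {r : ℝ}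
    (h : ∀ z ∈ spectrum ℂ T, dist z c ≠ r) {x : X} :
    x ∈ (discProj T c r).range ↔ discProj T c r x = x := by
  constructor
  · rintro ⟨y, rfl⟩
    exact DFunLike.congr_fun (discProj_mul_self h) y
  · exact fun hx => ⟨x, hx⟩

/-- If `Q` does not annihilate nonzero vectors in the range of `P'`, then the range of `P'` is no
larger than that of `Q`. -/
theorem finiteDimensional_of_forall_ne {P' Q : X →L[ℂ] X}
    (h : ∀ x ∈ P'.range, Q x = 0 → x = 0) [FiniteDimensional ℂ Q.range] :
    FiniteDimensional ℂ P'.range ∧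
      Module.finrank ℂ P'.range ≤ Module.finrank ℂ Q.range := by
  let L : P'.range →ₗ[ℂ] Q.range :=
    ((Q : X →ₗ[ℂ] X).domRestrict P'.range).codRestrict Q.range fun x => ⟨x, rfl⟩
  have hL : Function.Injective L := by
    rw [injective_iff_map_eq_zero]
    intro x hx
    exact Subtype.ext (h x x.2 (congrArg Subtype.val hx))
  exact ⟨Module.Finite.of_injective L hL, LinearMap.finrank_le_finrank_of_injective hL⟩

/-- The rank of a spectral projection is locally constant. -/
theorem exists_finrank_discProj_eq (T : X →L[ℂ] X) [IsStarNormal T] {c : ℂ} {r : ℝ} (hr : 0 < r)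
    (h : ∀ z ∈ spectrum ℂ T, dist z c ≠ r) [FiniteDimensional ℂ (discProj T c r).range] :
    ∃ η > 0, ∀ T' : X →L[ℂ] X, IsStarNormal T' → (∀ z ∈ spectrum ℂ T', dist z c ≠ r) →
      ‖T' - T‖ < η → FiniteDimensional ℂ (discProj T' c r).range ∧
        Module.finrank ℂ (discProj T' c r).range = Module.finrank ℂ (discProj T c r).range := by
  obtain ⟨η₀, hη₀, hgap₀⟩ := exists_gap_of_sphere h
  obtain ⟨η, hη, hηr, hgap⟩ : ∃ η > 0, η ≤ r ∧ ∀ z ∈ spectrum ℂ T, η ≤ |dist z c - r| :=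
    ⟨min η₀ r, lt_min hη₀ hr, min_le_right _ _, fun z hz => (min_le_left _ _).trans (hgap₀ z hz)⟩
  refine ⟨η, hη, fun T' hT' h' hTT' => ?_⟩
  have key : ∀ x, ‖(T' - c • 1) x‖ ≤ ‖(T - c • 1) x‖ + ‖T' - T‖ * ‖x‖ ∧
      ‖(T - c • 1) x‖ ≤ ‖(T' - c • 1) x‖ + ‖T' - T‖ * ‖x‖ := by
    intro x
    have e : (T' - c • 1) x = (T - c • 1) x + (T' - T) x := by simp
    have b := (T' - T).le_opNorm x
    rw [e]
    constructor
    · exact (norm_add_le _ _).trans (by gcongr)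
    · have := norm_sub_le ((T - c • 1) x + (T' - T) x) ((T' - T) x)
      rw [add_sub_cancel_right] at this
      linarith
  -- For such `x`, `T' - c` expands by at most `r` and `T - c` by at least `r + η`, while the
  -- operators differ by less than `η`.
  have h1 : ∀ x ∈ (discProj T' c r).range, discProj T c r x = 0 → x = 0 := by
    intro x hx hx0
    rw [mem_range_discProj h'] at hx
    have a := norm_sub_le_of_discProj h' hr.le (fun z _ hz => hz) hx
    have b := le_norm_sub_of_discProj h hr.le (ρ := r + η) (by positivity)
      (fun z hz hzr => by
        have := hgap z hz
        rw [abs_of_pos (by linarith)] at this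
        linarith) hx0
    have := (key x).2
    by_contra hne
    have hpos : 0 < ‖x‖ := norm_pos_iff.2 hne
    nlinarith
  -- Now `r - η` for `T` against `r` for `T'`: again only the gap of `T` enters, so `η` is
  -- independent of `T'`.
  have h2 : ∀ x ∈ (discProj T c r).range, discProj T' c r x = 0 → x = 0 := by
    intro x hx hx0
    rw [mem_range_discProj h] at hx
    have a := norm_sub_le_of_discProj h (ρ := r - η) (by linarith) (fun z hz hzr => by
        have := hgap z hz
        have hne := lt_of_le_of_ne hzr (h z hz)
        rw [abs_of_neg (by linarith)] at this
        linarith) hx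
    have b := le_norm_sub_of_discProj h' hr.le (ρ := r) hr (fun z hz hzr => hzr.le) hx0
    have := (key x).1
    by_contra hne
    have hpos : 0 < ‖x‖ := norm_pos_iff.2 hne
    nlinarith
  obtain ⟨hf, hle⟩ := finiteDimensional_of_forall_ne h1
  exact ⟨hf, le_antisymm hle (finiteDimensional_of_forall_ne h2).2⟩

end AbstractSF

end

/-! ### Eigenspaces and isolated points of the spectrum -/

noncomputable section

namespace AbstractSF

open Metric Set Filter Topology

variable {X : Type*} [NormedAddCommGroup X] [InnerProductSpace ℂ X]

/-- The kernel of `T - w`. -/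
abbrev eigKer (T : X →L[ℂ] X) (w : ℂ) : Submodule ℂ X :=
  LinearMap.ker ((T - w • 1 : X →L[ℂ] X) : X →ₗ[ℂ] X)

theorem mem_eigKer {T : X →L[ℂ] X} {w : ℂ} {x : X} : x ∈ eigKer T w ↔ T x = w • x := by
  simp [eigKer, sub_eq_zero]

theorem mem_spectrum_iff_sub {T : X →L[ℂ] X} {w : ℂ} :
    w ∈ spectrum ℂ T ↔ ¬ IsUnit (T - w • 1) := by
  rw [spectrum.mem_iff, Algebra.algebraMap_eq_smul_one, ← IsUnit.neg_iff, neg_sub]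

theorem mem_spectrum_of_mem_eigKer {T : X →L[ℂ] X} {w : ℂ} {x : X} (hx : x ∈ eigKer T w)
    (h0 : x ≠ 0) : w ∈ spectrum ℂ T := by
  rw [mem_spectrum_iff_sub]
  rintro ⟨u, hu⟩
  apply h0
  have h1 : (↑u⁻¹ * (T - w • 1)) x = 0 := by
    rw [mul_apply_eq_comp]
    have : (T - w • 1) x = 0 := hx
    rw [this, map_zero]
  rw [← hu] at h1
  simpa using h1

theorem eigKer_eq_bot_of_notMem {T : X →L[ℂ] X} {w : ℂ} (h : w ∉ spectrum ℂ T) :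
    eigKer T w = ⊥ := by
  rw [eq_bot_iff]
  intro x hx
  by_contra h0
  exact h (mem_spectrum_of_mem_eigKer hx h0)

theorem eigKer_neg_one (T : X →L[ℂ] X) :
    eigKer T (-1) = LinearMap.ker ((1 + T : X →L[ℂ] X) : X →ₗ[ℂ] X) := by
  rw [eigKer, neg_one_smul, sub_neg_eq_add, add_comm]

variable [CompleteSpace X]

section

variable {T : X →L[ℂ] X} [hT : IsStarNormal T] {c w : ℂ} {r : ℝ}

theorem eigKer_le_range_discProj (h : ∀ z ∈ spectrum ℂ T, dist z c ≠ r) (hw : dist w c ≤ r) :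
    eigKer T w ≤ (discProj T c r).range := by
  intro x hx
  rw [mem_range_discProj h]
  have h1 := DFunLike.congr_fun (discInv_mul_sub h hw) x
  have h2 : (T - w • 1) x = 0 := hx
  rw [mul_apply_eq_comp, h2, map_zero] at h1
  exact (sub_eq_zero.1 h1.symm).symm

/-- If `T - w` is injective, it is bijective on the finite-dimensional range of the projection, and
`discInv` inverts it on the complement; so `w` is not in the spectrum. -/
theorem eigKer_ne_bot_of_mem_spectrum (h : ∀ z ∈ spectrum ℂ T, dist z c ≠ r) (hw : dist w c ≤ r)
    [FiniteDimensional ℂ (discProj T c r).range] (hσ : w ∈ spectrum ℂ T) : eigKer T w ≠ ⊥ := by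
  intro hbot
  rw [mem_spectrum_iff_sub] at hσ
  apply hσ
  rw [ContinuousLinearMap.isUnit_iff_bijective]
  set N := T - w • (1 : X →L[ℂ] X) with hN
  have hinj : Function.Injective N := LinearMap.ker_eq_bot.1 hbot
  refine ⟨hinj, fun y => ?_⟩
  have hcomm : ∀ x, discProj T c r (N x) = N (discProj T c r x) := fun x =>
    DFunLike.congr_fun (commute_discProj_sub (T := T) (c := c) (r := r) (w := w)).eq x
  let L : (discProj T c r).range →ₗ[ℂ] (discProj T c r).range :=
    (N : X →ₗ[ℂ] X).restrict fun x hx => by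
      rw [mem_range_discProj h] at hx ⊢
      change discProj T c r (N x) = N x
      rw [hcomm, hx]
  have hL : Function.Injective L := fun a b hab => Subtype.ext (hinj (congrArg Subtype.val hab))
  obtain ⟨a, ha⟩ := (LinearMap.injective_iff_surjective.1 hL) ⟨discProj T c r y, y, rfl⟩
  have ha' : N a = discProj T c r y := congrArg Subtype.val ha
  have hb := DFunLike.congr_fun (sub_mul_discInv h hw) y
  refine ⟨discInv T c r w y + a, ?_⟩
  rw [map_add, ha']
  rw [mul_apply_eq_comp] at hb
  rw [hb]
  simp

theorem finite_spectrum_inter_closedBall (h : ∀ z ∈ spectrum ℂ T, dist z c ≠ r)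
    [FiniteDimensional ℂ (discProj T c r).range] :
    {z ∈ spectrum ℂ T | dist z c ≤ r}.Finite := by
  have hcomm : ∀ x, discProj T c r (T x) = T (discProj T c r x) := fun x => by
    have := (commute_discProj_sub (T := T) (c := c) (r := r) (w := 0)).eq
    rw [zero_smul, sub_zero] at this
    exact DFunLike.congr_fun this x
  let L : Module.End ℂ (discProj T c r).range :=
    (T : X →ₗ[ℂ] X).restrict fun x hx => by
      rw [mem_range_discProj h] at hx ⊢
      change discProj T c r (T x) = T x
      rw [hcomm, hx]
  refine L.finite_hasEigenvalue.subset fun z hz => ?_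
  obtain ⟨x, hx, hx0⟩ := Submodule.exists_mem_ne_zero_of_ne_bot
    (eigKer_ne_bot_of_mem_spectrum h hz.2 hz.1)
  have hxr := eigKer_le_range_discProj h hz.2 hx
  refine Module.End.hasEigenvalue_of_hasEigenvector (x := ⟨x, hxr⟩) ⟨?_, ?_⟩
  · rw [Module.End.mem_eigenspace_iff]
    exact Subtype.ext (mem_eigKer.1 hx)
  · exact fun h0 => hx0 (congrArg Subtype.val h0)

/-- `w` is the only point of the spectrum of `T` at distance at most `ρ` from `w`. -/
def IsolatedIn (T : X →L[ℂ] X) (w : ℂ) (ρ : ℝ) : Prop :=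
  0 < ρ ∧ ∀ z ∈ spectrum ℂ T, dist z w ≤ ρ → z = w

theorem IsolatedIn.dist_ne {ρ : ℝ} (h : IsolatedIn T w ρ) : ∀ z ∈ spectrum ℂ T, dist z w ≠ ρ := by
  intro z hz hd
  have := h.2 z hz hd.le
  rw [this, dist_self] at hd
  exact h.1.ne hd

theorem IsolatedIn.sub_mul_discProj {ρ : ℝ} (h : IsolatedIn T w ρ) :
    (T - w • 1) * discProj T w ρ = 0 := by
  rw [sub_smul_one_eq_cfc, discProj,
    ← cfc_mul _ _ T (by fun_prop) (continuousOn_proj_fun h.dist_ne), ← cfc_zero ℂ T]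
  refine cfc_congr fun z hz => ?_
  by_cases hzw : dist z w ≤ ρ
  · simp [h.2 z hz hzw]
  · simp [hzw]

theorem IsolatedIn.range_discProj {ρ : ℝ} (h : IsolatedIn T w ρ) :
    (discProj T w ρ).range = eigKer T w := by
  refine le_antisymm ?_ (eigKer_le_range_discProj h.dist_ne (by simpa using h.1.le))
  rintro _ ⟨y, rfl⟩
  exact DFunLike.congr_fun h.sub_mul_discProj y

theorem exists_isolatedIn_of_finite {r : ℝ} (hfin : {z ∈ spectrum ℂ T | dist z c ≤ r}.Finite)
    (hw : dist w c < r) : ∃ ρ, IsolatedIn T w ρ := by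
  have h1 : ({z ∈ spectrum ℂ T | dist z c ≤ r} \ {w})ᶜ ∈ 𝓝 w :=
    (hfin.subset sdiff_subset).isClosed.isOpen_compl.mem_nhds (by simp)
  have h2 : ball c r ∈ 𝓝 w := isOpen_ball.mem_nhds hw
  obtain ⟨ρ, hρ, hsub⟩ := nhds_basis_closedBall.mem_iff.1 (inter_mem h1 h2)
  refine ⟨ρ, hρ, fun z hz hzw => ?_⟩
  have := hsub (mem_closedBall.2 hzw)
  by_contra hne
  exact this.1 ⟨⟨hz, (mem_ball.1 this.2).le⟩, hne⟩

set_option maxHeartbeats 1000000 in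
/-- The rank of the spectral projection is the sum of the multiplicities of the eigenvalues in the
disc. -/
theorem finrank_range_discProj (h : ∀ z ∈ spectrum ℂ T, dist z c ≠ r) (F : Finset ℂ)
    (hF : ∀ z, z ∈ F ↔ z ∈ spectrum ℂ T ∧ dist z c ≤ r)
    (hfd : ∀ z ∈ F, FiniteDimensional ℂ (eigKer T z)) :
    FiniteDimensional ℂ (discProj T c r).range ∧
    Module.finrank ℂ (discProj T c r).range = ∑ z ∈ F, Module.finrank ℂ (eigKer T z) := by
  have hfin : {z ∈ spectrum ℂ T | dist z c ≤ r}.Finite :=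
    F.finite_toSet.subset fun z hz => (hF z).2 hz
  have hiso : ∀ w : F, ∃ ρ, IsolatedIn T w.1 ρ := fun w =>
    exists_isolatedIn_of_finite hfin
      (lt_of_le_of_ne ((hF _).1 w.2).2 (h _ ((hF _).1 w.2).1))
  choose ρ hρ using hiso
  have hsum : ∑ w : F, discProj T w.1 (ρ w) = discProj T c r := by
    simp only [discProj]
    rw [← cfc_sum_univ _ T fun w => continuousOn_proj_fun (hρ w).dist_ne]
    refine cfc_congr fun z hz => ?_
    rw [Finset.sum_apply]
    by_cases hzr : dist z c ≤ r
    · rw [if_pos hzr, Finset.sum_eq_single (⟨z, (hF z).2 ⟨hz, hzr⟩⟩ : F)]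
      · rw [if_pos (by simpa using (hρ _).1.le)]
      · intro w _ hne
        rw [if_neg]
        exact fun hd => hne (Subtype.ext ((hρ w).2 z hz hd).symm)
      · simp
    · rw [if_neg hzr]
      refine Finset.sum_eq_zero fun w _ => if_neg fun hd => hzr ?_
      rw [(hρ w).2 z hz hd]
      exact ((hF _).1 w.2).2
  have hort : ∀ w w' : F, w ≠ w' → discProj T w.1 (ρ w) * discProj T w'.1 (ρ w') = 0 := by
    intro w w' hne
    rw [discProj, discProj, ← cfc_mul _ _ T (continuousOn_proj_fun (hρ w).dist_ne)
      (continuousOn_proj_fun (hρ w').dist_ne), ← cfc_zero ℂ T]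
    refine cfc_congr fun z hz => ?_
    by_cases hd : dist z w.1 ≤ ρ w
    · have hd' : ¬ dist z w'.1 ≤ ρ w' := fun hd' =>
        hne (Subtype.ext (((hρ w).2 z hz hd).symm.trans ((hρ w').2 z hz hd')))
      simp [hd']
    · simp [hd]
  have hfix : ∀ (w : F) (y : eigKer T w.1), discProj T w.1 (ρ w) y = y := fun w y => by
    rw [← mem_range_discProj (hρ w).dist_ne, (hρ w).range_discProj]
    exact y.2
  have hzero : ∀ (w w' : F) (y : eigKer T w'.1), w ≠ w' → discProj T w.1 (ρ w) y = 0 :=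
    fun w w' y hne => by
      rw [← hfix w' y]
      exact DFunLike.congr_fun (hort w w' hne) (y : X)
  have hsx : ∀ v : X, discProj T c r v = ∑ w : F, discProj T w.1 (ρ w) v := fun v => by
    rw [← hsum, sum_apply]
  -- Splitting into eigencomponents. The projections sum to the projection of the disc (injectivity)
  -- and annihilate one another (surjectivity, with the sum of the components as preimage).
  let L : (discProj T c r).range →ₗ[ℂ] ((w : F) → eigKer T w.1) :=
    LinearMap.pi fun w => ((discProj T w.1 (ρ w) : X →ₗ[ℂ] X).domRestrict _).codRestrict
      (eigKer T w.1) fun x => by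
        rw [← (hρ w).range_discProj]
        exact ⟨x, rfl⟩
  have hLv : ∀ x w, ((L x w : eigKer T w.1) : X) = discProj T w.1 (ρ w) x := fun _ _ => rfl
  have hLinj : Function.Injective L := by
    rw [injective_iff_map_eq_zero]
    intro x hx
    have hx1 := (mem_range_discProj h).1 x.2
    rw [hsx] at hx1
    refine Subtype.ext (hx1.symm.trans (Finset.sum_eq_zero fun w _ => ?_))
    rw [← hLv, hx]
    rfl
  have hLsurj : Function.Surjective L := by
    intro y
    refine ⟨⟨∑ w, (y w : X), Submodule.sum_mem _ fun w _ =>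
      eigKer_le_range_discProj h ((hF _).1 w.2).2 (y w).2⟩, ?_⟩
    funext w
    refine Subtype.ext ?_
    rw [hLv, map_sum, Finset.sum_eq_single w, hfix]
    · exact fun w' _ hne => hzero w w' (y w') hne.symm
    · simp
  have : ∀ w : F, FiniteDimensional ℂ (eigKer T w.1) := fun w => hfd _ w.2
  let e := LinearEquiv.ofBijective L ⟨hLinj, hLsurj⟩
  refine ⟨Module.Finite.equiv e.symm, ?_⟩
  rw [e.finrank_eq, Module.finrank_pi_fintype,
    Finset.sum_coe_sort F fun w => Module.finrank ℂ (eigKer T w)]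

end

/-- If `T` is unitary and `1 + T` is Fredholm, then `-1` is isolated in the spectrum of `T`. -/
theorem exists_isolatedIn_neg_one {T : X →L[ℂ] X} (hT : T ∈ unitary (X →L[ℂ] X))
    (hF : (1 + T).IsFredholm) : ∃ ρ, IsolatedIn T (-1) ρ := by
  have hfd : FiniteDimensional ℂ (eigKer T (-1)) := by
    rw [eigKer_neg_one]
    exact hF.finite_ker
  set E := eigKer T (-1) with hE
  have hmemE : ∀ x, x ∈ E ↔ T x = -x := fun x => by rw [hE, mem_eigKer, neg_one_smul]
  have hadj : ∀ x y : X, inner ℂ (T x) (T y) = inner ℂ x y := by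
    intro x y
    rw [← ContinuousLinearMap.adjoint_inner_right, ← mul_apply_eq_comp,
      ← ContinuousLinearMap.star_eq_adjoint, (Unitary.mem_iff.1 hT).1]
    rfl
  have hT2 : T * star T = 1 := (Unitary.mem_iff.1 hT).2
  -- For unitary `T`, `E` is the orthogonal complement of the range of `1 + T`; the range is closed
  -- by the Fredholm property, so the double complement gives it back.
  have hrange : Eᗮ = (1 + T).range := by
    have hcl := hF.isClosed_range
    have : CompleteSpace (1 + T).range := hcl.completeSpace_coe
    rw [← Submodule.orthogonal_orthogonal (1 + T).range]
    congr 1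
    ext e
    rw [hmemE, Submodule.mem_orthogonal]
    constructor
    · rintro he _ ⟨x, rfl⟩
      have h1 := hadj x e
      rw [he, inner_neg_right] at h1
      simp only [ContinuousLinearMap.coe_coe, add_apply,
        one_apply_eq_self, inner_add_left, ← h1, neg_add_cancel]
    · intro he
      have h1 : ∀ x : X, inner ℂ (T x) (T e + e) = 0 := by
        intro x
        have := he _ ⟨x, rfl⟩
        simp only [ContinuousLinearMap.coe_coe, add_apply,
          one_apply_eq_self, inner_add_left] at this
        rw [inner_add_right, hadj, this]
      have h2 := h1 (star T (T e + e))
      rw [← mul_apply_eq_comp, hT2, one_apply_eq_self, inner_self_eq_zero] at h2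
      exact eq_neg_of_add_eq_zero_left h2
  set P := E.starProjection with hP
  have hTP : T * P = -P := by
    ext x
    exact (hmemE _).1 (E.starProjection_apply_mem x)
  have hPT : P * T = -P := by
    ext x
    have h0 : P ((1 + T) x) = 0 := by
      rw [hP, Submodule.starProjection_apply_eq_zero_iff, hrange]
      exact ⟨x, rfl⟩
    rw [add_apply, map_add, one_apply_eq_self] at h0
    exact eq_neg_of_add_eq_zero_right h0
  have hunit : IsUnit (T - (-1 : ℂ) • 1 + P) := by
    rw [ContinuousLinearMap.isUnit_iff_bijective]
    have hv : ∀ x, (T - (-1 : ℂ) • 1 + P) x = (1 + T) x + P x := fun x => by simp; abel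
    constructor
    · rw [injective_iff_map_eq_zero]
      intro x hx
      rw [hv] at hx
      have ha : (1 + T) x ∈ Eᗮ := by rw [hrange]; exact ⟨x, rfl⟩
      have hb : P x ∈ E := E.starProjection_apply_mem x
      have hPa : P ((1 + T) x) = 0 := (Submodule.starProjection_apply_eq_zero_iff E).2 ha
      have hPP : P (P x) = P x := Submodule.starProjection_eq_self_iff.2 hb
      have h1 := congrArg P hx
      rw [map_add, hPa, hPP, zero_add, map_zero] at h1
      rw [h1, add_zero, add_apply, one_apply_eq_self] at hx
      have hxE : x ∈ E := (hmemE x).2 (eq_neg_of_add_eq_zero_right hx)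
      rw [← h1]
      exact (Submodule.starProjection_eq_self_iff.2 hxE).symm
    · intro y
      have hy : y - P y ∈ (1 + T).range := by
        rw [← hrange, ← Submodule.starProjection_apply_eq_zero_iff, map_sub,
          sub_eq_zero]
        exact (Submodule.starProjection_eq_self_iff.2 (E.starProjection_apply_mem y)).symm
      obtain ⟨x, hx⟩ := hy
      have hx' : (1 + T) x = y - P y := hx
      have hzero : ∀ z, (1 + T) (P z) = 0 := fun z => by
        have := DFunLike.congr_fun hTP z
        rw [mul_apply_eq_comp] at this
        rw [add_apply, this]
        simp
      have hPP : ∀ z, P (P z) = P z := fun z =>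
        Submodule.starProjection_eq_self_iff.2 (E.starProjection_apply_mem z)
      refine ⟨x - P x + P y, ?_⟩
      rw [hv, map_add, map_sub, hzero, hzero, hx', map_add, map_sub, hPP, hPP]
      abel
  -- Adding `P` repairs the kernel at `-1`, and invertibility is an open condition.
  have hopen : ∀ᶠ w : ℂ in 𝓝 (-1), IsUnit (T - w • 1 + P) := by
    have hcont : Continuous fun w : ℂ => T - w • (1 : X →L[ℂ] X) + P := by fun_prop
    exact hcont.continuousAt.eventually (Units.isOpen.mem_nhds hunit)
  obtain ⟨ρ, hρ, hsub⟩ := nhds_basis_closedBall.mem_iff.1 hopen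
  refine ⟨ρ, hρ, fun z hz hd => ?_⟩
  by_contra hne
  have hu : IsUnit (T - z • 1 + P) := hsub (mem_closedBall.2 hd)
  have hz1 : -1 - z ≠ 0 := fun h0 => hne (sub_eq_zero.1 h0).symm
  -- On the range of `P`, `T - z` is the scalar `-1 - z`. Since the two factors commute,
  -- invertibility of the product passes to `T - z`.
  have e1 : T - z • 1 + P = (T - z • 1) * (1 + (-1 - z)⁻¹ • P) := by
    rw [mul_add, mul_one, mul_smul_comm, sub_mul, hTP, smul_mul_assoc, one_mul]
    congr 1
    rw [show -P - z • P = (-1 - z) • P by module, smul_smul, inv_mul_cancel₀ hz1, one_smul]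
  have e2 : (1 + (-1 - z)⁻¹ • P) * (T - z • 1) = T - z • 1 + P := by
    rw [add_mul, one_mul, smul_mul_assoc, mul_sub, hPT, mul_smul_comm, mul_one]
    congr 1
    rw [show -P - z • P = (-1 - z) • P by module, smul_smul, inv_mul_cancel₀ hz1, one_smul]
  have hcomm : Commute (T - z • 1) (1 + (-1 - z)⁻¹ • P) := e1.symm.trans e2.symm
  rw [e1, hcomm.isUnit_mul_iff] at hu
  exact mem_spectrum_iff_sub.1 hz hu.1

end AbstractSF

end

/-! ### First-order perturbation of a degenerate eigenvalue -/

noncomputable section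

namespace AbstractSF

open Metric Set Filter Topology

variable {X : Type*} [NormedAddCommGroup X] [InnerProductSpace ℂ X]

set_option maxHeartbeats 1000000 in
/-- A lower bound, of order `η`, for perturbations `N + iη (D - κ) + o(η)` of an operator `N`
with spectral projection `P` onto its kernel, uniform in those `κ` for which the compression of
`D - κ` to the kernel of `N` is uniformly bounded below. -/
theorem exists_lower_bound_of_compression {N P B D : X →L[ℂ] X} (hPN : P * N = 0)
    (hPP : P * P = P) (hBN : B * N = 1 - P) {F : ℝ → X →L[ℂ] X}
    (hF : ∀ ε > 0, ∀ᶠ η : ℝ in 𝓝[>] 0, ‖F η - N - (η * Complex.I : ℂ) • D‖ ≤ ε * η)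
    {S : Set ℂ} {K c : ℝ} (hK : ∀ κ ∈ S, ‖κ‖ ≤ K) (hK0 : 0 ≤ K) (hc : 0 < c)
    (hlow : ∀ κ ∈ S, ∀ y, P y = y → c * ‖y‖ ≤ ‖P (D y) - κ • y‖) :
    ∃ C > 0, ∀ᶠ η : ℝ in 𝓝[>] 0, ∀ κ ∈ S, ∀ u,
      η * ‖u‖ ≤ C * ‖(F η - (η * Complex.I * κ : ℂ) • 1) u‖ := by
  set b := ‖B‖ with hb
  set p₀ := ‖P‖ with hp₀
  have hb0 : 0 ≤ b := norm_nonneg _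
  have hp0 : 0 ≤ p₀ := norm_nonneg _
  set M := ‖D‖ + K + 1 with hM
  have hM0 : 1 ≤ M := by have := norm_nonneg D; linarith
  -- Chosen so that the `o(η)` term, seen through `P`, costs at most a quarter of the lower bound
  -- `c`.
  set ε := min 1 (c / (4 * p₀ + 1)) with hε
  have hε0 : 0 < ε := lt_min one_pos (by positivity)
  have hε1 : ε ≤ 1 := min_le_left _ _
  have hεp : p₀ * ε ≤ c / 4 := by
    calc p₀ * ε ≤ p₀ * (c / (4 * p₀ + 1)) := by gcongr; exact min_le_right _ _
      _ ≤ c / 4 := by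
        rw [mul_div_assoc', div_le_div_iff₀ (by positivity) (by norm_num)]
        nlinarith
  refine ⟨8 * p₀ / c + 2 * b + 1, by positivity, ?_⟩
  have hsmall : ∀ a > (0 : ℝ), ∀ᶠ η : ℝ in 𝓝[>] 0, 0 < η ∧ η ≤ a := fun a ha => by
    filter_upwards [Ioc_mem_nhdsGT ha] with η hη using hη
  -- `2bMη ≤ 1` absorbs `q` in its own estimate, and `8p₀bM²η ≤ c` makes the feedback of `q` into
  -- the estimate of `p` cost another quarter of `c`. The summands 1 keep the denominators positive
  -- when `b` or `p₀` vanishes.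
  filter_upwards [hF ε hε0, hsmall 1 one_pos, hsmall (1 / (2 * b * M + 1)) (by positivity),
    hsmall (c / (8 * p₀ * b * M ^ 2 + 1)) (by positivity)] with η h1 h2 h3 h4 κ hκ u
  obtain ⟨hη, hη1⟩ := h2
  have hbM : 2 * b * M * η ≤ 1 := by
    have := h3.2
    rw [le_div_iff₀ (by positivity)] at this
    nlinarith
  have hcM : 8 * p₀ * b * M ^ 2 * η ≤ c := by
    have := h4.2
    rw [le_div_iff₀ (by positivity)] at this
    nlinarith
  set τ := ‖(F η - (η * Complex.I * κ : ℂ) • 1) u‖ with hτ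
  set e := F η - N - (η * Complex.I : ℂ) • D with he
  have hηI : ‖(η * Complex.I : ℂ)‖ = η := by simp [abs_of_pos hη]
  have hN : N u = (F η - (η * Complex.I * κ : ℂ) • 1) u - (η * Complex.I : ℂ) • (D u - κ • u)
      - e u := by
    simp only [he, sub_apply, smul_apply, one_apply_eq_self,
      smul_sub, smul_smul]
    abel
  have heu : ∀ v, ‖e v‖ ≤ ε * η * ‖v‖ := fun v => e.le_of_opNorm_le h1 v
  set q := ‖u - P u‖ with hq
  set p := ‖P u‖ with hp
  have hupq : ‖u‖ ≤ p + q := by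
    calc ‖u‖ = ‖P u + (u - P u)‖ := by rw [add_sub_cancel]
      _ ≤ p + q := norm_add_le _ _
  have hp00 : 0 ≤ p := norm_nonneg _
  have hq00 : 0 ≤ q := norm_nonneg _
  have hτ0 : 0 ≤ τ := norm_nonneg _
  have hDk : ∀ v, ‖D v - κ • v‖ ≤ (‖D‖ + K) * ‖v‖ := fun v => by
    calc ‖D v - κ • v‖ ≤ ‖D v‖ + ‖κ • v‖ := norm_sub_le _ _
      _ ≤ ‖D‖ * ‖v‖ + K * ‖v‖ := by
        rw [norm_smul]
        gcongr
        · exact D.le_opNorm v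
        · exact hK κ hκ
      _ = _ := by ring
  -- The component off the kernel is recovered from `N u` by `B`.
  have hq1 : q ≤ b * (τ + η * M * (p + q)) := by
    have hBu : u - P u = B (N u) := by
      have := DFunLike.congr_fun hBN u
      rw [mul_apply_eq_comp] at this
      rw [this]; rfl
    calc q = ‖B (N u)‖ := by rw [hq, hBu]
      _ ≤ b * ‖N u‖ := B.le_opNorm _
      _ ≤ b * (τ + η * ((‖D‖ + K) * ‖u‖) + ε * η * ‖u‖) := by
        gcongr
        rw [hN]
        refine (norm_sub_le _ _).trans (add_le_add ((norm_sub_le _ _).trans ?_) (heu u))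
        rw [norm_smul, hηI]
        gcongr
        exact hDk u
      _ = b * (τ + η * (‖D‖ + K + ε) * ‖u‖) := by ring
      _ ≤ b * (τ + η * M * (p + q)) := by
        gcongr
        linarith
  have hq2 : q ≤ 2 * b * (τ + η * M * p) := by nlinarith
  have hPu : P (P u) = P u := DFunLike.congr_fun hPP u
  -- Applying `P` kills `N`, and what remains on the kernel is the compression of `D - κ`, bounded
  -- below by `hlow`.
  have hp1 : η * (c * p) ≤ p₀ * (τ + η * M * q) + p₀ * ε * η * p := by
    have hPNu : P (N u) = 0 := DFunLike.congr_fun hPN u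
    have heq : (η * Complex.I : ℂ) • (P (D (P u)) - κ • P u)
        = P ((F η - (η * Complex.I * κ : ℂ) • 1) u
          - (η * Complex.I : ℂ) • (D (u - P u) - κ • (u - P u)) - e u)
          := by
      have h0 := hPNu
      rw [hN] at h0
      have h5 : (η * Complex.I : ℂ) • (D (u - P u) - κ • (u - P u))
          = (η * Complex.I : ℂ) • (D u - κ • u)
            - (η * Complex.I : ℂ) • (D (P u) - κ • P u) := by
        rw [map_sub]; module
      rw [h5]
      rw [show ∀ a b' c' d : X, a - (b' - c') - d = (a - b' - d) + c' from fun _ _ _ _ => by abel,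
        map_add, h0, zero_add, map_smul, map_sub, map_smul, hPu]
    calc η * (c * p) ≤ η * ‖P (D (P u)) - κ • P u‖ := by
          gcongr
          exact hlow κ hκ _ hPu
      _ = ‖(η * Complex.I : ℂ) • (P (D (P u)) - κ • P u)‖ := by rw [norm_smul, hηI]
      _ ≤ p₀ * (τ + η * ((‖D‖ + K) * q) + ε * η * ‖u‖) := by
        rw [heq]
        refine (P.le_opNorm _).trans ?_
        gcongr
        refine (norm_sub_le _ _).trans (add_le_add ((norm_sub_le _ _).trans ?_) (heu u))
        rw [norm_smul, hηI]
        gcongr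
        exact hDk _
      _ ≤ p₀ * (τ + η * ((‖D‖ + K) * q) + ε * η * (p + q)) := by gcongr
      _ = p₀ * (τ + η * (‖D‖ + K + ε) * q) + p₀ * ε * η * p := by ring
      _ ≤ p₀ * (τ + η * M * q) + p₀ * ε * η * p := by
        gcongr
        linarith
  have hp2 : η * p * c ≤ 4 * p₀ * τ := by
    have h6 : p₀ * ε * η * p ≤ c / 4 * (η * p) := by
      calc p₀ * ε * η * p = p₀ * ε * (η * p) := by ring
        _ ≤ c / 4 * (η * p) := by gcongr
    have h7 : p₀ * (η * M * q) ≤ p₀ * τ + c / 4 * (η * p) := by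
      calc p₀ * (η * M * q) ≤ p₀ * (η * M * (2 * b * (τ + η * M * p))) := by gcongr
        _ = (2 * b * M * η) * (p₀ * τ) + (8 * p₀ * b * M ^ 2 * η) / 4 * (η * p) := by ring
        _ ≤ 1 * (p₀ * τ) + c / 4 * (η * p) := by gcongr
        _ = _ := by ring
    linarith
  have hp3 : η * p ≤ 4 * p₀ / c * τ := by
    rw [div_mul_eq_mul_div, le_div_iff₀ hc]
    exact hp2
  calc η * ‖u‖ ≤ η * p + η * q := by nlinarith
    _ ≤ 4 * p₀ / c * τ + (2 * b * τ + 4 * p₀ / c * τ) := by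
      refine add_le_add hp3 ?_
      calc η * q ≤ η * (2 * b * (τ + η * M * p)) := by gcongr
        _ = η * (2 * b * τ) + (2 * b * M * η) * (η * p) := by ring
        _ ≤ 1 * (2 * b * τ) + 1 * (4 * p₀ / c * τ) := by gcongr
        _ = _ := by ring
    _ = (8 * p₀ / c + 2 * b) * τ := by ring
    _ ≤ (8 * p₀ / c + 2 * b + 1) * τ := by nlinarith

/-- First-order perturbation of a degenerate eigenvalue: near an isolated eigenvalue `κ₀` of the
compression of `D` to the kernel of `N`, there are singular points of
`κ ↦ N + iη (D - κ) + o(η)`. -/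
theorem not_eventually_isUnit_of_compression [CompleteSpace X] {N P B D : X →L[ℂ] X}
    (hPN : P * N = 0) (hNP : N * P = 0)
    (hPP : P * P = P) (hBN : B * N = 1 - P) (hNB : N * B = 1 - P) {F : ℝ → X →L[ℂ] X}
    (hF : ∀ ε > 0, ∀ᶠ η : ℝ in 𝓝[>] 0, ‖F η - N - (η * Complex.I : ℂ) • D‖ ≤ ε * η)
    {κ₀ : ℂ} {ρ c : ℝ} (hρ : 0 < ρ) (hc : 0 < c)
    (hlow : ∀ κ ∈ sphere κ₀ ρ, ∀ y, P y = y → c * ‖y‖ ≤ ‖P (D y) - κ • y‖)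
    {x : X} (hPx : P x = x) (hx0 : x ≠ 0) (hx : P (D x) = κ₀ • x) :
    ¬ ∀ᶠ η : ℝ in 𝓝[>] 0, ∀ κ ∈ closedBall κ₀ ρ,
      IsUnit (F η - (η * Complex.I * κ : ℂ) • (1 : X →L[ℂ] X)) := by
  intro hunit
  have hK : ∀ κ ∈ sphere κ₀ ρ, ‖κ‖ ≤ ‖κ₀‖ + ρ := fun κ hκ => by
    calc ‖κ‖ = ‖κ₀ + (κ - κ₀)‖ := by rw [add_sub_cancel]
      _ ≤ ‖κ₀‖ + ρ := (norm_add_le _ _).trans (by rw [← dist_eq_norm, mem_sphere.1 hκ])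
  obtain ⟨C, hC, hbound⟩ := exists_lower_bound_of_compression hPN hPP hBN hF hK (by positivity)
    hc hlow
  -- If there were no singular points in the disc, the inverse would be analytic in `κ` and the
  -- maximum principle would carry the bound `C / η` from the circle to the centre.
  have hcenter : ∀ᶠ η : ℝ in 𝓝[>] 0, ∀ u,
      η * ‖u‖ ≤ C * ‖(F η - (η * Complex.I * κ₀ : ℂ) • 1) u‖ := by
    filter_upwards [hbound, hunit, self_mem_nhdsWithin] with η h1 h2 hη u
    rw [mem_Ioi] at hη
    set T : ℂ → X →L[ℂ] X := fun κ => F η - (η * Complex.I * κ : ℂ) • 1 with hT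
    have hTd : Differentiable ℂ T := by fun_prop
    have hd : DiffContOnCl ℂ (fun κ => Ring.inverse (T κ)) (ball κ₀ ρ) := by
      apply DifferentiableOn.diffContOnCl
      rw [closure_ball _ hρ.ne']
      intro κ hκ
      exact ((differentiableAt_inverse (𝕜 := ℂ) (h2 κ hκ)).comp κ
        hTd.differentiableAt).differentiableWithinAt
    have hR : ‖Ring.inverse (T κ₀)‖ ≤ C / η := by
      refine Complex.norm_le_of_forall_mem_frontier_norm_le isBounded_ball hd (fun κ hκ => ?_)
        (subset_closure (mem_ball_self hρ))
      rw [frontier_ball _ hρ.ne'] at hκ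
      refine ContinuousLinearMap.opNorm_le_bound _ (by positivity) fun v => ?_
      have h3 := h1 κ hκ (Ring.inverse (T κ) v)
      have h4 : T κ (Ring.inverse (T κ) v) = v := by
        rw [← mul_apply_eq_comp, Ring.mul_inverse_cancel _ (h2 κ (sphere_subset_closedBall hκ))]
        rfl
      change _ ≤ C * ‖T κ (Ring.inverse (T κ) v)‖ at h3
      rw [h4] at h3
      rw [div_mul_eq_mul_div, le_div_iff₀ hη]
      linarith
    have h5 : Ring.inverse (T κ₀) (T κ₀ u) = u := by
      rw [← mul_apply_eq_comp, Ring.inverse_mul_cancel _ (h2 κ₀ (mem_closedBall_self hρ.le))]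
      rfl
    have h6 := (Ring.inverse (T κ₀)).le_of_opNorm_le hR (T κ₀ u)
    rw [h5, div_mul_eq_mul_div, le_div_iff₀ hη] at h6
    linarith
  -- First-order corrector: `P (D x - κ₀ x) = 0` makes `N y = -(D x - κ₀ x)` solvable, so `x + iη y`
  -- is an approximate null vector with error `O(η²)` plus `o(η)`, which violates the bound at the
  -- centre.
  set y := -B (D x - κ₀ • x) with hy
  have hNy : N y = -(D x - κ₀ • x) := by
    have := DFunLike.congr_fun hNB (D x - κ₀ • x)
    rw [mul_apply_eq_comp] at this
    rw [hy, map_neg, this]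
    simp [hx, hPx]
  have hNx : N x = 0 := by
    have := DFunLike.congr_fun hNP x
    rw [mul_apply_eq_comp, hPx] at this
    exact this
  set G := ‖D y - κ₀ • y‖ with hG
  have hG0 : 0 ≤ G := norm_nonneg _
  have hxpos : 0 < ‖x‖ := norm_pos_iff.2 hx0
  set A := 2 * C * G + ‖y‖ with hA
  have hA0 : 0 ≤ A := by positivity
  have hsmall : ∀ᶠ η : ℝ in 𝓝[>] 0, η ∈ Ioc 0 (‖x‖ / (2 * (A + 1))) :=
    Ioc_mem_nhdsGT (by positivity)
  -- With tolerance `1 / (2C)`, the `o(η)` term takes only half of the left side of `hcenter`.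
  obtain ⟨η, ⟨h1, h2⟩, hη, hη2⟩ :=
    ((hcenter.and (hF (1 / (2 * C)) (by positivity))).and hsmall).exists
  set e := F η - N - (η * Complex.I : ℂ) • D with he
  set v := x + (η * Complex.I : ℂ) • y with hv
  have hηI : ‖(η * Complex.I : ℂ)‖ = η := by simp [abs_of_pos hη]
  have hTv : (F η - (η * Complex.I * κ₀ : ℂ) • 1) v
      = ((η * Complex.I) * (η * Complex.I) : ℂ) • (D y - κ₀ • y) + e v := by
    have : F η = e + N + (η * Complex.I : ℂ) • D := by rw [he]; abel
    rw [this]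
    have hNv : N v = (η * Complex.I : ℂ) • (-(D x - κ₀ • x)) := by
      rw [hv, map_add, map_smul, hNx, hNy, zero_add]
    have hDv : D v = D x + (η * Complex.I : ℂ) • D y := by rw [hv, map_add, map_smul]
    simp only [sub_apply, add_apply, smul_apply, one_apply_eq_self, hNv, hDv]
    rw [show v = x + (η * Complex.I : ℂ) • y from hv]
    module
  have h3 := h1 v
  have h4 : ‖(F η - (η * Complex.I * κ₀ : ℂ) • 1) v‖ ≤ η * η * G + 1 / (2 * C) * η * ‖v‖ := by
    rw [hTv]
    refine (norm_add_le _ _).trans (add_le_add ?_ (e.le_of_opNorm_le h2 v))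
    rw [norm_smul, norm_mul, hηI]
  have h5 : η * ‖v‖ ≤ η * (η * (2 * C * G)) := by
    have h6 : η * ‖v‖ ≤ C * (η * η * G + 1 / (2 * C) * η * ‖v‖) := h3.trans (by gcongr)
    have h7 : C * (1 / (2 * C) * η * ‖v‖) = η * ‖v‖ / 2 := by field_simp
    rw [mul_add, h7] at h6
    linarith
  have h6 : ‖v‖ ≤ η * (2 * C * G) := le_of_mul_le_mul_left h5 hη
  have h7 : ‖x‖ ≤ η * A := by
    calc ‖x‖ = ‖v - (η * Complex.I : ℂ) • y‖ := by rw [hv, add_sub_cancel_right]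
      _ ≤ ‖v‖ + η * ‖y‖ := (norm_sub_le _ _).trans (by rw [norm_smul, hηI])
      _ ≤ η * A := by rw [hA]; linarith
  have h8 : η * (2 * (A + 1)) ≤ ‖x‖ := by rwa [le_div_iff₀ (by positivity)] at hη2
  nlinarith

end AbstractSF

end

/-! ### The sign of the derivative on eigenspaces -/

noncomputable section

namespace AbstractSF

open Metric Set Filter Topology
open scoped ComplexConjugate

theorem exists_pos_eigenvalue_of_inner_pos {E : Type*} [NormedAddCommGroup E]
    [InnerProductSpace ℂ E] [FiniteDimensional ℂ E] {A : E →ₗ[ℂ] E} (hA : A.IsSymmetric) {x : E}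
    (hx : 0 < (inner ℂ x (A x)).re) :
    ∃ (h : ℝ) (v : E), 0 < h ∧ v ≠ 0 ∧ A v = (h : ℂ) • v := by
  by_contra! hcon
  set b := hA.eigenvectorBasis rfl with hb
  have hle : ∀ i, hA.eigenvalues rfl i ≤ 0 := fun i => by
    by_contra! hi
    exact hcon _ (b i) hi (b.orthonormal.ne_zero i) (hA.apply_eigenvectorBasis rfl i)
  have : (inner ℂ x (A x)).re = ∑ i, hA.eigenvalues rfl i * ‖inner ℂ (b i) x‖ ^ 2 := by
    rw [← b.sum_inner_mul_inner x (A x), Complex.re_sum]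
    refine Finset.sum_congr rfl fun i _ => ?_
    rw [← hA (b i) x, hA.apply_eigenvectorBasis rfl i, inner_smul_left, ← hb,
      ← inner_conj_symm x (b i)]
    simp only [Complex.coe_algebraMap, Complex.conj_ofReal]
    rw [mul_left_comm, Complex.conj_mul']
    norm_cast
  rw [this] at hx
  exact hx.not_ge (Finset.sum_nonpos fun i _ => mul_nonpos_of_nonpos_of_nonneg (hle i) (by positivity))

/-- The eigenvalues are finite in number, so some small circle about `κ₀` avoids them; compactness
of the circle times the unit sphere makes the bound uniform. -/
theorem exists_sphere_lower_bound {E : Type*} [NormedAddCommGroup E]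
    [NormedSpace ℂ E] [FiniteDimensional ℂ E] (A : E →ₗ[ℂ] E) (κ₀ : ℂ) {h : ℝ} (hh : 0 < h) :
    ∃ ρ c : ℝ, 0 < ρ ∧ ρ < h ∧ 0 < c ∧ ∀ κ ∈ sphere κ₀ ρ, ∀ y, c * ‖y‖ ≤ ‖A y - κ • y‖ := by
  have h1 : ({κ | Module.End.HasEigenvalue A κ} \ {κ₀})ᶜ ∈ 𝓝 κ₀ :=
    ((Module.End.finite_hasEigenvalue A).subset sdiff_subset).isClosed.isOpen_compl.mem_nhds
      (by simp)
  obtain ⟨ρ, hρ, hsub⟩ := nhds_basis_closedBall.mem_iff.1 (inter_mem h1 (ball_mem_nhds κ₀ hh))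
  have hρh : ρ < h := by
    have : κ₀ + ρ ∈ closedBall κ₀ ρ := by simp [abs_of_pos hρ]
    simpa [abs_of_pos hρ] using (hsub this).2
  have := FiniteDimensional.proper ℂ E
  have hne : ∀ p ∈ sphere κ₀ ρ ×ˢ sphere (0 : E) 1, 0 < ‖A p.2 - p.1 • p.2‖ := by
    rintro ⟨κ, y⟩ ⟨hκ, hy⟩
    rw [norm_pos_iff, sub_ne_zero]
    intro heq
    have hy0 : y ≠ 0 := by
      rintro rfl
      simp at hy
    have hev : Module.End.HasEigenvalue A κ :=
      Module.End.hasEigenvalue_of_hasEigenvector ⟨Module.End.mem_eigenspace_iff.2 heq, hy0⟩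
    refine (hsub (sphere_subset_closedBall hκ)).1 ⟨hev, ?_⟩
    rintro rfl
    simp only [mem_sphere, dist_self] at hκ
    exact hρ.ne hκ
  have hcont : Continuous fun p : ℂ × E => ‖A p.2 - p.1 • p.2‖ := by
    have : Continuous A := A.continuous_of_finiteDimensional
    fun_prop
  obtain ⟨c, hc, hmin⟩ := ((isCompact_sphere κ₀ ρ).prod (isCompact_sphere (0 : E) 1)).exists_forall_le'
    hcont.continuousOn hne
  refine ⟨ρ, c, hρ, hρh, hc, fun κ hκ y => ?_⟩
  rcases eq_or_ne y 0 with rfl | hy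
  · simp
  have hy' : 0 < ‖y‖ := norm_pos_iff.2 hy
  have h2 := hmin (κ, ((‖y‖⁻¹ : ℝ) : ℂ) • y) ⟨hκ, by
    simp [norm_smul, hy'.ne']⟩
  simp only [map_smul] at h2
  rw [smul_comm κ, ← smul_sub, norm_smul, Complex.norm_real, norm_inv, norm_norm,
    inv_mul_eq_div, le_div_iff₀ hy'] at h2
  exact h2

variable {X : Type*} [NormedAddCommGroup X] [InnerProductSpace ℂ X] [CompleteSpace X]

theorem inner_map_map_of_mem_unitary {T : X →L[ℂ] X} (hT : T ∈ unitary (X →L[ℂ] X)) (x y : X) :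
    inner ℂ (T x) (T y) = inner ℂ x y := by
  rw [← ContinuousLinearMap.adjoint_inner_right, ← mul_apply_eq_comp,
    ← ContinuousLinearMap.star_eq_adjoint, (Unitary.mem_iff.1 hT).1]
  rfl

theorem isStarNormal_of_mem_unitary {T : X →L[ℂ] X} (hT : T ∈ unitary (X →L[ℂ] X)) :
    IsStarNormal T :=
  ⟨(Unitary.mem_iff.1 hT).1.trans (Unitary.mem_iff.1 hT).2.symm⟩

/-- For a family that is unitary on the real axis, the derivative is skew-adjoint on eigenspaces. -/
theorem inner_deriv_add_inner_deriv {U : ℂ → X →L[ℂ] X} {s : ℝ} {D : X →L[ℂ] X}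
    (hD : HasDerivAt U D (s : ℂ)) (hunit : ∀ᶠ t : ℝ in 𝓝 s, U t ∈ unitary (X →L[ℂ] X))
    (x y : X) : inner ℂ (U s x) (D y) + inner ℂ (D x) (U s y) = 0 := by
  have hv : ∀ v : X, HasDerivAt (fun t : ℝ => U t v) (D v) s := fun v => by
    have h1 : HasDerivAt (fun z : ℂ => U z v) (D v) s :=
      (ContinuousLinearMap.apply ℂ X v).hasFDerivAt.comp_hasDerivAt (s : ℂ) hD
    simpa using! h1.scomp s Complex.ofRealCLM.hasDerivAt
  have h2 := (hv x).inner ℂ (hv y)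
  have h3 : HasDerivAt (fun t : ℝ => inner ℂ (U t x) (U t y)) (0 : ℂ) s := by
    refine (hasDerivAt_const s (inner ℂ x y)).congr_of_eventuallyEq ?_
    filter_upwards [hunit] with t ht
    exact inner_map_map_of_mem_unitary ht x y
  exact h2.unique h3

/-- `|1 + iηκ|² = 1 - 2η Im κ + η²|κ|²`, and the linear term dominates for small `η`. -/
theorem norm_one_add_mul_I_le_one {κ : ℂ} {η a M : ℝ} (ha : a ≤ κ.im) (hM : ‖κ‖ ≤ M)
    (hη : 0 ≤ η) (hηM : η * M ^ 2 ≤ 2 * a) : ‖1 + η * Complex.I * κ‖ ≤ 1 := by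
  rw [← sq_le_one_iff₀ (norm_nonneg _), ← Complex.normSq_eq_norm_sq, Complex.normSq_apply]
  have h1 : κ.re * κ.re + κ.im * κ.im ≤ M ^ 2 := by
    rw [← Complex.normSq_apply, Complex.normSq_eq_norm_sq]
    gcongr
  simp only [Complex.add_re, Complex.one_re, Complex.mul_re, Complex.ofReal_re, Complex.I_re,
    Complex.ofReal_im, Complex.I_im, Complex.mul_im, Complex.add_im, Complex.one_im]
  nlinarith [mul_le_mul_of_nonneg_left h1 (mul_nonneg hη hη), mul_le_mul_of_nonneg_left hηM hη,
    mul_le_mul_of_nonneg_left ha hη]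

/-- Isolated eigenvalues of finite multiplicity of a family that is unitary on the real axis, with
spectrum outside the unit disc in the upper half plane, do not move counterclockwise to first
order. -/
theorem im_inner_deriv_nonpos {U : ℂ → X →L[ℂ] X} {s : ℝ} {D : X →L[ℂ] X}
    (hD : HasDerivAt U D (s : ℂ)) (hunit : ∀ᶠ t : ℝ in 𝓝 s, U t ∈ unitary (X →L[ℂ] X))
    (hup : ∀ᶠ η : ℝ in 𝓝[>] 0, spectrum ℂ (U (s + η * Complex.I)) ⊆ {w | 1 < ‖w‖})
    {w : ℂ} (hw : ‖w‖ = 1) {ρ : ℝ} (hiso : IsolatedIn (U s) w ρ)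
    [FiniteDimensional ℂ (eigKer (U s) w)] {x : X} (hx : x ∈ eigKer (U s) w) :
    (inner ℂ x (conj w • D x)).im ≤ 0 := by
  by_contra! hpos
  have hUs := hunit.self_of_nhds
  have hnorm : IsStarNormal (U s) := isStarNormal_of_mem_unitary hUs
  have hww : conj w * w = 1 := by rw [Complex.conj_mul', hw]; simp
  set P := discProj (U s) w ρ with hP
  set B₀ := discInv (U s) w ρ w with hB₀
  have hd : dist w w ≤ ρ := by simpa using hiso.1.le
  have hPP : P * P = P := discProj_mul_self hiso.dist_ne
  have hTP : (U s - w • 1) * P = 0 := hiso.sub_mul_discProj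
  have hPT : P * (U s - w • 1) = 0 := by rw [← hTP, hP, commute_discProj_sub.eq]
  have hBT : B₀ * (U s - w • 1) = 1 - P := discInv_mul_sub hiso.dist_ne hd
  have hTB : (U s - w • 1) * B₀ = 1 - P := sub_mul_discInv hiso.dist_ne hd
  have hPmem : ∀ v, P v = v ↔ v ∈ eigKer (U s) w := fun v => by
    rw [← hiso.range_discProj, mem_range_discProj hiso.dist_ne]
  have hPmem' : ∀ v, P v ∈ eigKer (U s) w := fun v => by
    rw [← hiso.range_discProj]
    exact ⟨v, rfl⟩
  have hPsymm : ∀ u v, inner ℂ (P u) v = inner ℂ u (P v) := fun u v => by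
    rw [← ContinuousLinearMap.adjoint_inner_right, ← ContinuousLinearMap.star_eq_adjoint, hP,
      star_discProj]
  set D' : X →L[ℂ] X := conj w • D with hD'
  have hskew : ∀ u ∈ eigKer (U s) w, ∀ v ∈ eigKer (U s) w,
      inner ℂ u (D' v) + inner ℂ (D' u) v = 0 := by
    intro u hu v hv
    have := inner_deriv_add_inner_deriv hD hunit u v
    rw [mem_eigKer.1 hu, mem_eigKer.1 hv, inner_smul_left, inner_smul_right] at this
    rw [hD', smul_apply, smul_apply, inner_smul_left, inner_smul_right, Complex.conj_conj]
    exact this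
  let E := eigKer (U s) w
  -- The compression of `D'` to the eigenspace; `hskew` makes `-i C` symmetric, so a positive value
  -- of its quadratic form yields an eigenvalue `h > 0`.
  let C : E →ₗ[ℂ] E := (((P * D' : X →L[ℂ] X) : X →ₗ[ℂ] X).domRestrict E).codRestrict E
    fun v => hPmem' _
  have hCv : ∀ v : E, ((C v : E) : X) = P (D' v) := fun _ => rfl
  have hinner : ∀ u v : E, inner ℂ u (C v) = inner ℂ (u : X) (D' v) := fun u v => by
    rw [Submodule.coe_inner, hCv, ← hPsymm, (hPmem _).2 u.2]
  have hinner' : ∀ u v : E, inner ℂ (C u) v = inner ℂ (D' u) (v : X) := fun u v => by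
    rw [Submodule.coe_inner, hCv, hPsymm, (hPmem _).2 v.2]
  have hsymm : ((-Complex.I) • C).IsSymmetric := by
    intro u v
    rw [LinearMap.smul_apply, LinearMap.smul_apply, inner_smul_left, inner_smul_right, hinner,
      hinner', eq_neg_of_add_eq_zero_left (hskew u u.2 v v.2)]
    simp
  obtain ⟨h, v, hh, hv0, hv⟩ := exists_pos_eigenvalue_of_inner_pos hsymm (x := ⟨x, hx⟩) (by
    rw [LinearMap.smul_apply, inner_smul_right, hinner]
    simpa [hD'] using hpos)
  have hCv0 : C v = (h * Complex.I : ℂ) • v := by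
    calc C v = Complex.I • ((-Complex.I) • C) v := by
          rw [LinearMap.smul_apply, smul_smul]
          simp
      _ = (h * Complex.I : ℂ) • v := by rw [hv, smul_smul, mul_comm]
  -- `ρ' < h` keeps the whole disc about `ih` in the open upper half plane; there `w (1 + iηκ)` has
  -- modulus at most 1 and is off the spectrum of `U (s + iη)`, contradicting the existence of
  -- singular points.
  obtain ⟨ρ', c, hρ', hρh, hc, hlow⟩ := exists_sphere_lower_bound C (h * Complex.I) hh
  refine not_eventually_isUnit_of_compression (N := conj w • (U s - w • 1)) (P := P)
    (B := w • B₀) (D := D') (F := fun η => conj w • (U (s + η * Complex.I)) - 1)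
    (κ₀ := h * Complex.I) (ρ := ρ') (c := c) (x := (v : X)) ?_ ?_ hPP ?_ ?_ ?_ hρ' hc ?_
    ((hPmem _).2 v.2) (fun h0 => hv0 (Subtype.ext h0)) (congrArg Subtype.val hCv0) ?_
  · rw [mul_smul_comm, hPT, smul_zero]
  · rw [smul_mul_assoc, hTP, smul_zero]
  · rw [smul_mul_smul_comm, hBT, mul_comm, hww, one_smul]
  · rw [smul_mul_smul_comm, hTB, hww, one_smul]
  · intro ε hε
    have h1 := hD.isLittleO.def hε
    have htend : Tendsto (fun η : ℝ => (s + η * Complex.I : ℂ)) (𝓝[>] 0) (𝓝 (s : ℂ)) := by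
      have : Continuous fun η : ℝ => (s + η * Complex.I : ℂ) := by fun_prop
      have h2 := this.tendsto 0
      simp only [Complex.ofReal_zero, zero_mul, add_zero] at h2
      exact h2.mono_left nhdsWithin_le_nhds
    filter_upwards [htend.eventually h1, self_mem_nhdsWithin] with η hη hη0
    rw [mem_Ioi] at hη0
    rw [add_sub_cancel_left] at hη
    have e : conj w • U (s + η * Complex.I) - 1 - conj w • (U s - w • 1)
        - (η * Complex.I : ℂ) • D'
        = conj w • (U (s + η * Complex.I) - U s - (η * Complex.I : ℂ) • D) := by
      rw [smul_sub, smul_smul, hww, hD', smul_sub, smul_sub, one_smul, smul_comm (conj w)]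
      abel
    rw [e, norm_smul, RCLike.norm_conj, hw, one_mul]
    refine hη.trans (le_of_eq ?_)
    simp [abs_of_pos hη0]
  · intro κ hκ y hy
    exact hlow κ hκ ⟨y, (hPmem y).1 hy⟩
  · have hsmall : ∀ᶠ η : ℝ in 𝓝[>] 0, η ∈ Ioc 0 (2 * (h - ρ') / ((2 * h) ^ 2 + 1)) :=
      Ioc_mem_nhdsGT (div_pos (by linarith) (by positivity))
    filter_upwards [hup, hsmall] with η hη hηs κ hκ
    obtain ⟨hη0, hη1⟩ := hηs
    rw [le_div_iff₀ (by positivity)] at hη1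
    have hκ' : ‖κ - h * Complex.I‖ ≤ ρ' := by rwa [mem_closedBall, dist_eq_norm] at hκ
    have him : h - ρ' ≤ κ.im := by
      have := (Complex.abs_im_le_norm (κ - h * Complex.I)).trans hκ'
      simp only [Complex.sub_im, Complex.mul_im, Complex.ofReal_re, Complex.I_im, mul_one,
        Complex.ofReal_im, Complex.I_re, mul_zero, add_zero] at this
      linarith [(abs_le.1 this).1]
    have hκn : ‖κ‖ ≤ 2 * h := by
      calc ‖κ‖ = ‖(κ - h * Complex.I) + h * Complex.I‖ := by rw [sub_add_cancel]
        _ ≤ ρ' + h := (norm_add_le _ _).trans (add_le_add hκ' (by simp [abs_of_pos hh]))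
        _ ≤ 2 * h := by linarith
    have hle := norm_one_add_mul_I_le_one him hκn hη0.le (by nlinarith)
    have hns : w * (1 + η * Complex.I * κ) ∉ spectrum ℂ (U (s + η * Complex.I)) := by
      intro hmem
      have := hη hmem
      rw [mem_ofPred_eq, norm_mul, hw, one_mul] at this
      linarith
    rw [mem_spectrum_iff_sub, not_not] at hns
    have e : conj w • U (s + η * Complex.I) - 1 - (η * Complex.I * κ : ℂ) • (1 : X →L[ℂ] X)
        = conj w • (U (s + η * Complex.I) - (w * (1 + η * Complex.I * κ)) • 1) := by
      rw [smul_sub, smul_smul, ← mul_assoc, hww, one_mul, add_smul, one_smul]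
      abel
    have hwu : IsUnit (conj w) := by
      rw [isUnit_iff_ne_zero]
      intro h0
      rw [h0, zero_mul] at hww
      exact zero_ne_one hww
    rw [e]
    exact (isUnit_smul_iff hwu.unit _).2 hns

end AbstractSF

end

/-! ### Dini derivatives of angles and clockwise motion -/

noncomputable section

namespace AbstractSF

open Metric Set Filter Topology
open scoped ComplexConjugate

variable {X : Type*} [NormedAddCommGroup X] [InnerProductSpace ℂ X]

set_option maxHeartbeats 1000000 in
-- Pairing the eigenvalue equation with `P u` gives `sin φ ‖P u‖² = z Im ⟪P u, D P u⟫` up to an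
-- error small compared with `z`, and the main term has the sign of `-z` or vanishes. The product
-- form `φ z < γ z²` says `φ / z < γ` for both signs of `z`.
theorem exists_angle_mul_lt {N P B D : X →L[ℂ] X} (hPN : P * N = 0) (hPP : P * P = P)
    (hPs : ∀ u v, inner ℂ (P u) v = inner ℂ u (P v)) (hBN : B * N = 1 - P)
    (hneg : ∀ x, P x = x → (inner ℂ x (D x)).im ≤ 0) {γ : ℝ} (hγ : 0 < γ) :
    ∃ δ > 0, ∀ z : ℝ, z ≠ 0 → |z| < δ → ∀ e : X →L[ℂ] X, ‖e‖ ≤ δ * |z| → ∀ φ : ℝ, |φ| < δ →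
      ∀ u, u ≠ 0 → (N + (z : ℂ) • D + e) u = (Complex.exp (φ * Complex.I) - 1) • u →
        φ * z < γ * z ^ 2 := by
  -- Unlike `B`, `B'` is known to kill the range of `P`, so `μ P u` drops out and `q` is bounded by
  -- a multiple of `|z| p`.
  set B' := B * (1 - P) with hB'
  have hBN' : B' * N = 1 - P := by rw [hB', mul_assoc, sub_mul, hPN, one_mul, sub_zero, hBN]
  have hBP' : B' * P = 0 := by rw [hB', mul_assoc, sub_mul, hPP, one_mul, sub_self, mul_zero]
  set b := ‖B'‖ with hb
  set M := ‖D‖ + 1 with hM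
  set p₀ := ‖P‖ with hp₀
  have hb0 : 0 ≤ b := norm_nonneg _
  have hp0 : 0 ≤ p₀ := norm_nonneg _
  have hM1 : 1 ≤ M := by have := norm_nonneg D; linarith
  obtain ⟨δ, hδ, hδ1, hδ2, hδ3⟩ : ∃ δ > 0, δ ≤ 1 ∧ 4 * b * M * δ ≤ 1 ∧
      p₀ * δ * (2 * b * M ^ 2 + 2) ≤ γ / 2 := by
    refine ⟨min 1 (min (1 / (4 * b * M + 1)) (γ / (2 * (p₀ * (2 * b * M ^ 2 + 2)) + 1))),
      lt_min one_pos (lt_min (by positivity) (by positivity)), min_le_left _ _, ?_, ?_⟩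
    · calc _ ≤ 4 * b * M * (1 / (4 * b * M + 1)) := by
            gcongr
            exact (min_le_right _ _).trans (min_le_left _ _)
        _ ≤ 1 := by
            rw [mul_one_div, div_le_one (by positivity)]
            linarith
    · set Q := p₀ * (2 * b * M ^ 2 + 2) with hQ
      have hQ0 : 0 ≤ Q := by positivity
      calc _ = Q * min 1 (min (1 / (4 * b * M + 1)) (γ / (2 * Q + 1))) := by rw [hQ]; ring
        _ ≤ Q * (γ / (2 * Q + 1)) := by
            gcongr
            exact (min_le_right _ _).trans (min_le_right _ _)
        _ ≤ γ / 2 := by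
            rw [mul_div_assoc', div_le_div_iff₀ (by positivity) (by norm_num)]
            nlinarith
  refine ⟨δ, hδ, fun z hz hzδ e he φ hφ u hu heq => ?_⟩
  have hz0 : 0 < |z| := abs_pos.2 hz
  have hz2 : 0 < z ^ 2 := by positivity
  set μ := Complex.exp (φ * Complex.I) - 1 with hμ
  have hμn : ‖μ‖ ≤ δ := by
    rw [hμ, mul_comm]
    exact (Real.norm_exp_I_mul_ofReal_sub_one_le).trans hφ.le
  have hNu : N u = μ • u - ((z : ℂ) • D u + e u) := by
    rw [← heq]
    simp only [add_apply, smul_apply]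
    abel
  set q := ‖u - P u‖ with hq
  set p := ‖P u‖ with hp
  have hp00 : 0 ≤ p := norm_nonneg _
  have hq00 : 0 ≤ q := norm_nonneg _
  have hPu : P (P u) = P u := DFunLike.congr_fun hPP u
  have hupq : ‖u‖ ≤ p + q := by
    calc ‖u‖ = ‖P u + (u - P u)‖ := by rw [add_sub_cancel]
      _ ≤ p + q := norm_add_le _ _
  have hDe : ‖(z : ℂ) • D u + e u‖ ≤ |z| * M * (p + q) := by
    calc ‖(z : ℂ) • D u + e u‖ ≤ |z| * (‖D‖ * ‖u‖) + δ * |z| * ‖u‖ := by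
          refine (norm_add_le _ _).trans (add_le_add ?_ (e.le_of_opNorm_le he u))
          rw [norm_smul, Complex.norm_real, Real.norm_eq_abs]
          gcongr
          exact D.le_opNorm u
      _ = |z| * (‖D‖ + δ) * ‖u‖ := by ring
      _ ≤ |z| * M * (p + q) := by gcongr; linarith
  have hq1 : q ≤ b * (δ * q + |z| * M * (p + q)) := by
    have hBu : u - P u = B' (μ • (u - P u) - ((z : ℂ) • D u + e u)) := by
      have h1 : B' (N u) = u - P u := DFunLike.congr_fun hBN' u
      have h2 : B' (P u) = 0 := DFunLike.congr_fun hBP' u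
      have h3 : B' (μ • (u - P u) - ((z : ℂ) • D u + e u)) = B' (N u) := by
        rw [hNu, map_sub, map_sub, map_smul, map_smul, map_sub, h2, sub_zero]
      rw [h3, h1]
    calc q = ‖B' (μ • (u - P u) - ((z : ℂ) • D u + e u))‖ := by rw [← hBu]
      _ ≤ b * ‖μ • (u - P u) - ((z : ℂ) • D u + e u)‖ := B'.le_opNorm _
      _ ≤ b * (δ * q + |z| * M * (p + q)) := by
        gcongr
        refine (norm_sub_le _ _).trans (add_le_add ?_ hDe)
        rw [norm_smul]
        gcongr
  have hbM : b ≤ b * M := le_mul_of_one_le_right hb0 hM1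
  have hq2 : q ≤ 2 * b * M * |z| * p := by
    have h1 : b * M * |z| ≤ 1 / 4 := by
      have : b * M * |z| ≤ b * M * δ := by gcongr
      linarith
    have h2 : b * δ ≤ 1 / 4 := by
      have : b * δ ≤ b * M * δ := by gcongr
      linarith
    have h3 : b * δ * q ≤ 1 / 4 * q := by gcongr
    have h4 : b * M * |z| * q ≤ 1 / 4 * q := by gcongr
    nlinarith
  have hppos : 0 < p := by
    rcases hp00.lt_or_eq with h | h
    · exact h
    · exfalso
      rw [← h, mul_zero] at hq2
      have : ‖u‖ ≤ 0 := by linarith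
      exact hu (norm_le_zero_iff.1 this)
  set E := D (u - P u) with hE
  have hPuD : μ • P u = (z : ℂ) • P (D (P u)) + P ((z : ℂ) • E + e u) := by
    have h0 : P (N u) = 0 := DFunLike.congr_fun hPN u
    rw [hNu, map_sub, map_smul, sub_eq_zero] at h0
    rw [h0, hE]
    simp only [map_add, map_smul, map_sub, smul_sub]
    abel
  have hin : μ * (p ^ 2 : ℝ) = (z : ℂ) * inner ℂ (P u) (D (P u))
      + inner ℂ (P u) ((z : ℂ) • E + e u) := by
    have h1 := congrArg (fun v => inner ℂ (P u) v) hPuD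
    simp only [inner_smul_right, inner_add_right, map_add, map_smul] at h1
    rw [inner_self_eq_norm_sq_to_K, ← hPs, ← hPs, ← hPs, hPu] at h1
    rw [inner_add_right, inner_smul_right]
    simpa [hp] using h1
  have hμim : μ.im = Real.sin φ := by
    rw [hμ, Complex.sub_im, Complex.exp_ofReal_mul_I_im]
    simp
  have him := congrArg Complex.im hin
  rw [Complex.im_mul_ofReal, hμim, Complex.add_im, Complex.im_ofReal_mul] at him
  have herr : |(inner ℂ (P u) ((z : ℂ) • E + e u)).im| ≤ |z| * (γ / 2) * p ^ 2 := by
    by_cases hP0 : p₀ = 0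
    · exfalso
      have : ‖P u‖ ≤ p₀ * ‖u‖ := P.le_opNorm u
      rw [hP0, zero_mul] at this
      exact hppos.not_ge this
    have hp1 : 1 ≤ p₀ := by
      have h1 : ‖P * P‖ ≤ p₀ * p₀ := norm_mul_le _ _
      rw [hPP] at h1
      have h2 : 0 < p₀ := lt_of_le_of_ne hp0 (Ne.symm hP0)
      exact le_of_mul_le_mul_right (by rwa [one_mul]) h2
    calc |(inner ℂ (P u) ((z : ℂ) • E + e u)).im| ≤ ‖inner ℂ (P u) ((z : ℂ) • E + e u)‖ :=
          Complex.abs_im_le_norm _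
      _ ≤ p * ‖(z : ℂ) • E + e u‖ := norm_inner_le_norm _ _
      _ ≤ p * (|z| * (M * (2 * b * M * |z| * p)) + δ * |z| * (2 * p)) := by
        gcongr
        refine (norm_add_le _ _).trans (add_le_add ?_ ?_)
        · rw [norm_smul, Complex.norm_real, Real.norm_eq_abs]
          gcongr
          refine (D.le_opNorm _).trans ?_
          gcongr
          linarith
        · refine (e.le_of_opNorm_le he u).trans ?_
          gcongr
          have : 2 * b * M * |z| ≤ 1 := by
            have : b * M * |z| ≤ b * M * δ := by gcongr
            linarith
          nlinarith
      _ = |z| * p ^ 2 * (2 * b * M ^ 2 * |z| + 2 * δ) := by ring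
      _ ≤ |z| * p ^ 2 * (2 * b * M ^ 2 * δ + 2 * δ) := by gcongr
      _ = |z| * p ^ 2 * (1 * δ * (2 * b * M ^ 2 + 2)) := by ring
      _ ≤ |z| * p ^ 2 * (p₀ * δ * (2 * b * M ^ 2 + 2)) := by gcongr
      _ ≤ |z| * p ^ 2 * (γ / 2) := by gcongr
      _ = |z| * (γ / 2) * p ^ 2 := by ring
  have hsin : Real.sin φ * z ≤ γ / 2 * z ^ 2 := by
    have h1 : Real.sin φ * z * p ^ 2 ≤ γ / 2 * z ^ 2 * p ^ 2 := by
      have h2 : z * (inner ℂ (P u) ((z : ℂ) • E + e u)).im ≤ γ / 2 * z ^ 2 * p ^ 2 := by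
        calc _ ≤ |z| * |(inner ℂ (P u) ((z : ℂ) • E + e u)).im| := by
              rw [← abs_mul]; exact le_abs_self _
          _ ≤ |z| * (|z| * (γ / 2) * p ^ 2) := by gcongr
          _ = γ / 2 * |z| ^ 2 * p ^ 2 := by ring
          _ = _ := by rw [sq_abs]
      have h3 : z * z * (inner ℂ (P u) (D (P u))).im ≤ 0 :=
        mul_nonpos_of_nonneg_of_nonpos (mul_self_nonneg z) (hneg _ hPu)
      calc Real.sin φ * z * p ^ 2 = z * (Real.sin φ * p ^ 2) := by ring
        _ = z * z * (inner ℂ (P u) (D (P u))).im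
            + z * (inner ℂ (P u) ((z : ℂ) • E + e u)).im := by rw [him]; ring
        _ ≤ _ := by linarith
    exact le_of_mul_le_mul_right h1 (by positivity)
  -- Jordan's inequality `(2/π)|φ| ≤ |sin φ|` and `2/π > 1/2` convert the bound on `sin φ` into one
  -- on `φ`; this is why `γ / 2` was aimed at.
  by_contra! hcon
  have hφ1 : |φ| ≤ Real.pi / 2 := by
    have := Real.pi_gt_three
    linarith
  have hpos : 0 < φ * z := lt_of_lt_of_le (by positivity) hcon
  have hkey : 2 / Real.pi * (φ * z) ≤ Real.sin φ * z := by
    rcases pos_and_pos_or_neg_and_neg_of_mul_pos hpos with ⟨h1, h2⟩ | ⟨h1, h2⟩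
    · have := Real.mul_le_sin h1.le (by rwa [abs_of_pos h1] at hφ1)
      nlinarith
    · have := Real.mul_le_sin (x := -φ) (by linarith) (by rwa [abs_of_neg h1] at hφ1)
      rw [Real.sin_neg] at this
      nlinarith
  have hpi : 1 / 2 < 2 / Real.pi := by
    rw [div_lt_div_iff₀ (by norm_num) Real.pi_pos]
    linarith [Real.pi_lt_four]
  nlinarith

/-- The eigenvalues of a family that is unitary on the real axis, with spectrum outside the unit
disc in the upper half plane, have nonpositive angular Dini derivatives. -/
theorem exists_angle_mul_lt_of_eigenvector [CompleteSpace X] {U : ℂ → X →L[ℂ] X} {s : ℝ}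
    {D : X →L[ℂ] X}
    (hD : HasDerivAt U D (s : ℂ)) (hunit : ∀ᶠ t : ℝ in 𝓝 s, U t ∈ unitary (X →L[ℂ] X))
    (hup : ∀ᶠ η : ℝ in 𝓝[>] 0, spectrum ℂ (U (s + η * Complex.I)) ⊆ {w | 1 < ‖w‖})
    {w : ℂ} (hw : ‖w‖ = 1) {ρ : ℝ} (hiso : IsolatedIn (U s) w ρ)
    [FiniteDimensional ℂ (eigKer (U s) w)] {γ : ℝ} (hγ : 0 < γ) :
    ∃ δ > 0, ∀ t : ℝ, t ≠ s → |t - s| < δ → ∀ φ : ℝ, |φ| < δ →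
      eigKer (U t) (w * Complex.exp (φ * Complex.I)) ≠ ⊥ → φ * (t - s) < γ * (t - s) ^ 2 := by
  have hUs := hunit.self_of_nhds
  have hnorm : IsStarNormal (U s) := isStarNormal_of_mem_unitary hUs
  have hww : conj w * w = 1 := by rw [Complex.conj_mul', hw]; simp
  set P := discProj (U s) w ρ with hP
  have hd : dist w w ≤ ρ := by simpa using hiso.1.le
  have hPT : P * (U s - w • 1) = 0 := by
    rw [← hiso.sub_mul_discProj, hP, commute_discProj_sub.eq]
  have hBT : discInv (U s) w ρ w * (U s - w • 1) = 1 - P := discInv_mul_sub hiso.dist_ne hd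
  obtain ⟨δ₀, hδ₀, h⟩ := exists_angle_mul_lt (N := conj w • (U s - w • 1)) (P := P)
    (B := w • discInv (U s) w ρ w) (D := conj w • D)
    (by rw [mul_smul_comm, hPT, smul_zero]) (discProj_mul_self hiso.dist_ne)
    (fun u v => by
      rw [← ContinuousLinearMap.adjoint_inner_right, ← ContinuousLinearMap.star_eq_adjoint, hP,
        star_discProj])
    (by rw [smul_mul_smul_comm, hBT, mul_comm, hww, one_smul])
    (fun x hx => im_inner_deriv_nonpos hD hunit hup hw hiso (by
      rw [← hiso.range_discProj]
      exact ⟨x, hx⟩)) hγ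
  have h1 := hD.isLittleO.def hδ₀
  have h2 : ∀ᶠ t : ℝ in 𝓝 s, ‖U t - U s - ((t : ℂ) - s) • D‖ ≤ δ₀ * ‖(t : ℂ) - s‖ :=
    (Complex.continuous_ofReal.tendsto s).eventually h1
  obtain ⟨δ₁, hδ₁, h3⟩ := Metric.eventually_nhds_iff.1 h2
  refine ⟨min δ₀ δ₁, lt_min hδ₀ hδ₁, fun t hts ht φ hφ hne => ?_⟩
  obtain ⟨u, hu, hu0⟩ := Submodule.exists_mem_ne_zero_of_ne_bot hne
  rw [mem_eigKer] at hu
  have h4 := h3 (y := t) (by rw [Real.dist_eq]; exact ht.trans_le (min_le_right _ _))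
  refine h (t - s) (sub_ne_zero.2 hts) (ht.trans_le (min_le_left _ _))
    (conj w • (U t - U s - ((t : ℂ) - s) • D)) ?_ φ (hφ.trans_le (min_le_left _ _)) u hu0 ?_
  · rw [norm_smul, RCLike.norm_conj, hw, one_mul]
    refine h4.trans (le_of_eq ?_)
    rw [← Complex.ofReal_sub, Complex.norm_real, Real.norm_eq_abs]
  · have : conj w • (U s - w • 1) + ((t - s : ℝ) : ℂ) • conj w • D
        + conj w • (U t - U s - ((t : ℂ) - s) • D) = conj w • U t - (conj w * w) • 1 := by
      push_cast
      module
    rw [this, hww, sub_apply, smul_apply, hu, smul_smul, ← mul_assoc, hww]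
    simp [sub_smul]

/-- If the points of a closed set move clockwise, none can appear at positive angles. -/
theorem notMem_of_moves_clockwise {S : Set (ℝ × ℝ)} {s t₁ ε : ℝ} (hst : s < t₁)
    (hcl : IsClosed (S ∩ Icc s t₁ ×ˢ Icc 0 ε)) (hs : ∀ θ ∈ Ioc 0 ε, (s, θ) ∉ S)
    (hmove : ∀ t ∈ Ioc s t₁, ∀ θ ∈ Ioc 0 ε, (t, θ) ∈ S → ∀ γ > 0,
      ∃ t' ∈ Ico s t, ∃ θ' ∈ Icc 0 ε, (t', θ') ∈ S ∧ θ - γ * (t - t') ≤ θ') :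
    ∀ θ ∈ Ioc 0 ε, (t₁, θ) ∉ S := by
  intro θ₁ hθ₁ hmem
  -- With this slope, the line descending backwards in time from `(t₁, θ₁)` is still at height `θ₁ /
  -- 2 > 0` at time `s`.
  set γ := θ₁ / (2 * (t₁ - s)) with hγ
  have hts : 0 < t₁ - s := sub_pos.2 hst
  have hγ0 : 0 < γ := div_pos hθ₁.1 (by positivity)
  have hγs : γ * (t₁ - s) = θ₁ / 2 := by rw [hγ]; field_simp
  set A : Set (ℝ × ℝ) := (S ∩ Icc s t₁ ×ˢ Icc 0 ε) ∩ {p | θ₁ - γ * (t₁ - p.1) ≤ p.2} with hA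
  have hAc : IsCompact A := by
    refine (isCompact_Icc.prod isCompact_Icc).of_isClosed_subset
      (hcl.inter (isClosed_le (by fun_prop) (by fun_prop))) ?_ (s := Icc s t₁ ×ˢ Icc 0 ε)
    exact fun p hp => hp.1.2
  have hAne : A.Nonempty := ⟨(t₁, θ₁), ⟨hmem, ⟨hst.le, le_rfl⟩, hθ₁.1.le, hθ₁.2⟩, by simp⟩
  -- The earliest point of `S` on or above the line: at time `s` it contradicts `hs`, later `hmove`
  -- produces an earlier one.
  obtain ⟨⟨t, θ⟩, ⟨⟨hS, ht, hθ⟩, hle⟩, hmin⟩ := hAc.exists_isMinOn hAne continuous_fst.continuousOn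
  simp only [mem_ofPred_eq] at hle ht hθ
  have hθpos : 0 < θ := by
    have : γ * (t₁ - t) ≤ γ * (t₁ - s) := by
      gcongr
      exact ht.1
    linarith [hθ₁.1]
  rcases ht.1.eq_or_lt with rfl | hlt
  · exact hs θ ⟨hθpos, hθ.2⟩ hS
  · obtain ⟨t', ht', θ', hθ', hS', hle'⟩ := hmove t ⟨hlt, ht.2⟩ θ ⟨hθpos, hθ.2⟩ hS γ hγ0
    have : (t', θ') ∈ A := ⟨⟨hS', ⟨ht'.1, ht'.2.le.trans ht.2⟩, hθ'⟩, by
      change θ₁ - γ * (t₁ - t') ≤ θ'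
      linarith⟩
    have h5 := hmin this
    simp only [mem_ofPred_eq] at h5
    exact ht'.2.not_ge h5

end AbstractSF

end

/-! ### Arcs of the unit circle as sections of discs -/

noncomputable section

namespace AbstractSF

open Metric Set Filter Topology
open scoped ComplexConjugate

theorem norm_circlePt (θ : ℝ) : ‖circlePt θ‖ = 1 := Complex.norm_exp_ofReal_mul_I _

theorem circlePt_zero : circlePt 0 = -1 := by simp [circlePt]

theorem circlePt_add (θ φ : ℝ) : circlePt (θ + φ) = circlePt θ * Complex.exp (φ * Complex.I) := by
  rw [circlePt, circlePt, ← Complex.exp_add]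
  congr 1
  push_cast
  ring

theorem continuous_circlePt : Continuous circlePt := by
  unfold circlePt
  fun_prop

theorem dist_circlePt_add (φ x : ℝ) :
    dist (circlePt (φ + x)) (circlePt φ) = 2 * |Real.sin (x / 2)| := by
  rw [dist_eq_norm, circlePt_add, ← mul_sub_one, norm_mul, norm_circlePt, one_mul, mul_comm (x : ℂ),
    Complex.norm_exp_I_mul_ofReal_sub_one, norm_mul, Real.norm_eq_abs, Real.norm_eq_abs]
  norm_num

theorem exists_circlePt_eq {z : ℂ} (hz : ‖z‖ = 1) (φ : ℝ) :
    ∃ x, |x| ≤ Real.pi ∧ z = circlePt (φ + x) := by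
  refine ⟨Complex.arg (z / circlePt φ), Complex.abs_arg_le_pi _, ?_⟩
  have h0 : circlePt φ ≠ 0 := Complex.exp_ne_zero _
  have h1 := Complex.norm_mul_exp_arg_mul_I (z / circlePt φ)
  rw [norm_div, hz, norm_circlePt, div_one, Complex.ofReal_one, one_mul] at h1
  rw [circlePt_add, h1, mul_div_cancel₀ _ h0]

theorem abs_sin_half {x : ℝ} (hx : |x| ≤ Real.pi) : |Real.sin (x / 2)| = Real.sin (|x| / 2) := by
  rcases le_total 0 x with h | h
  · rw [abs_of_nonneg h] at hx ⊢
    exact abs_of_nonneg (Real.sin_nonneg_of_nonneg_of_le_pi (by linarith) (by linarith))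
  · rw [abs_of_nonpos h] at hx ⊢
    rw [neg_div, Real.sin_neg]
    refine abs_of_nonpos (Real.sin_nonpos_of_nonpos_of_neg_pi_le (by linarith) (by linarith))

/-- The chord `2 sin (|x| / 2)` is strictly increasing on `[0, π]`. Arcs are thus cut out by discs,
which makes `discProj` available for them. -/
theorem dist_circlePt_add_le_iff {φ x h : ℝ} (hx : |x| ≤ Real.pi) (h0 : 0 ≤ h)
    (hh : h ≤ Real.pi) :
    dist (circlePt (φ + x)) (circlePt φ) ≤ 2 * Real.sin (h / 2) ↔ |x| ≤ h := by
  rw [dist_circlePt_add, abs_sin_half hx, mul_le_mul_iff_right₀ two_pos,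
    Real.strictMonoOn_sin.le_iff_le ⟨by linarith [abs_nonneg x, Real.pi_pos], by linarith⟩
      ⟨by linarith [Real.pi_pos], by linarith⟩, div_le_div_iff_of_pos_right two_pos]

theorem dist_circlePt_add_eq_iff {φ x h : ℝ} (hx : |x| ≤ Real.pi) (h0 : 0 ≤ h)
    (hh : h ≤ Real.pi) :
    dist (circlePt (φ + x)) (circlePt φ) = 2 * Real.sin (h / 2) ↔ |x| = h := by
  rw [dist_circlePt_add, abs_sin_half hx, mul_right_inj' two_ne_zero,
    Real.strictMonoOn_sin.injOn.eq_iff ⟨by linarith [abs_nonneg x, Real.pi_pos], by linarith⟩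
      ⟨by linarith [Real.pi_pos], by linarith⟩, div_left_inj' two_ne_zero]

theorem circlePt_injOn {φ h : ℝ} (hh : h < Real.pi) : InjOn circlePt (Icc (φ - h) (φ + h)) := by
  intro x hx y hy hxy
  have h1 : |x - y| < 2 * Real.pi := by
    rw [abs_lt]
    constructor <;> linarith [hx.1, hx.2, hy.1, hy.2]
  have h2 := dist_circlePt_add y (x - y)
  rw [add_sub_cancel, hxy, dist_self, eq_comm, mul_eq_zero, abs_eq_zero] at h2
  rcases h2 with h2 | h2
  · norm_num at h2
  · have h3 := (Real.sin_eq_zero_iff_of_lt_of_lt (by linarith [(abs_lt.1 h1).1])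
      (by linarith [(abs_lt.1 h1).2])).1 h2
    linarith

variable {X : Type*} [NormedAddCommGroup X] [InnerProductSpace ℂ X] [CompleteSpace X]

theorem norm_eq_one_of_mem_spectrum {T : X →L[ℂ] X} (hT : T ∈ unitary (X →L[ℂ] X)) {z : ℂ}
    (hz : z ∈ spectrum ℂ T) : ‖z‖ = 1 := by
  simpa using spectrum.subset_circle_of_unitary hT hz

/-- The spectral projection of a unitary operator for the arc of points at angular distance at most
`h` from `circlePt φ`. -/
def arcProj (T : X →L[ℂ] X) (φ h : ℝ) : X →L[ℂ] X :=
  discProj T (circlePt φ) (2 * Real.sin (h / 2))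

theorem two_mul_sin_half_pos {h : ℝ} (h0 : 0 < h) (hh : h < Real.pi) : 0 < 2 * Real.sin (h / 2) :=
  mul_pos two_pos (Real.sin_pos_of_pos_of_lt_pi (by linarith) (by linarith))

section

variable {T : X →L[ℂ] X} (hT : T ∈ unitary (X →L[ℂ] X)) {φ h : ℝ}

include hT

theorem dist_ne_of_notMem_spectrum (h0 : 0 < h) (hh : h < Real.pi)
    (hr : circlePt (φ + h) ∉ spectrum ℂ T) (hl : circlePt (φ - h) ∉ spectrum ℂ T) :
    ∀ z ∈ spectrum ℂ T, dist z (circlePt φ) ≠ 2 * Real.sin (h / 2) := by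
  intro z hz hd
  obtain ⟨x, hx, rfl⟩ := exists_circlePt_eq (norm_eq_one_of_mem_spectrum hT hz) φ
  rw [dist_circlePt_add_eq_iff hx h0.le hh.le] at hd
  rcases (abs_eq h0.le).1 hd with rfl | rfl
  · exact hr hz
  · exact hl (by rwa [sub_eq_add_neg])

theorem spectrum_inter_disc_eq (h0 : 0 < h) (hh : h < Real.pi) :
    {z ∈ spectrum ℂ T | dist z (circlePt φ) ≤ 2 * Real.sin (h / 2)} =
      circlePt '' {θ ∈ Icc (φ - h) (φ + h) | circlePt θ ∈ spectrum ℂ T} := by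
  ext z
  constructor
  · rintro ⟨hz, hd⟩
    obtain ⟨x, hx, rfl⟩ := exists_circlePt_eq (norm_eq_one_of_mem_spectrum hT hz) φ
    rw [dist_circlePt_add_le_iff hx h0.le hh.le, abs_le] at hd
    exact ⟨φ + x, ⟨⟨by linarith, by linarith⟩, hz⟩, rfl⟩
  · rintro ⟨θ, ⟨hθ, hz⟩, rfl⟩
    refine ⟨hz, ?_⟩
    have hx : |θ - φ| ≤ h := abs_le.2 ⟨by linarith [hθ.1], by linarith [hθ.2]⟩
    rw [← dist_circlePt_add_le_iff (hx.trans hh.le) h0.le hh.le (φ := φ), add_sub_cancel] at hx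
    exact hx

/-- The rank of an arc projection is the number of eigenvalues in the arc, with multiplicity. -/
theorem finsum_finrank_eigKer_eq (h0 : 0 < h) (hh : h < Real.pi)
    (hr : circlePt (φ + h) ∉ spectrum ℂ T) (hl : circlePt (φ - h) ∉ spectrum ℂ T)
    (hfin : {θ ∈ Icc (φ - h) (φ + h) | circlePt θ ∈ spectrum ℂ T}.Finite)
    (hfd : ∀ θ ∈ Icc (φ - h) (φ + h), FiniteDimensional ℂ (eigKer T (circlePt θ))) :
    FiniteDimensional ℂ (arcProj T φ h).range ∧
      ∑ᶠ θ ∈ Icc (φ - h) (φ + h), Module.finrank ℂ (eigKer T (circlePt θ)) =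
        Module.finrank ℂ (arcProj T φ h).range := by
  classical
  have hnorm := isStarNormal_of_mem_unitary hT
  have hF : ∀ z, z ∈ hfin.toFinset.image circlePt ↔
      z ∈ spectrum ℂ T ∧ dist z (circlePt φ) ≤ 2 * Real.sin (h / 2) := by
    intro z
    have := Set.ext_iff.1 (spectrum_inter_disc_eq hT h0 hh (φ := φ)) z
    rw [mem_ofPred_eq] at this
    rw [this]
    simp
  obtain ⟨h1, h2⟩ := finrank_range_discProj (dist_ne_of_notMem_spectrum hT h0 hh hr hl) _ hF (by
    intro z hz
    obtain ⟨θ, hθ, rfl⟩ := Finset.mem_image.1 hz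
    exact hfd θ ((hfin.mem_toFinset.1 hθ).1))
  refine ⟨h1, ?_⟩
  rw [arcProj, h2, Finset.sum_image]
  · apply finsum_mem_eq_sum_of_inter_support_eq
    ext θ
    simp only [mem_inter_iff, Function.mem_support, Finset.mem_coe, Set.Finite.mem_toFinset,
      mem_ofPred_eq]
    constructor
    · rintro ⟨hθ, hne⟩
      refine ⟨⟨hθ, ?_⟩, hne⟩
      by_contra hns
      rw [eigKer_eq_bot_of_notMem hns, finrank_bot] at hne
      exact hne rfl
    · rintro ⟨⟨hθ, -⟩, hne⟩
      exact ⟨hθ, hne⟩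
  · intro x hx y hy hxy
    exact circlePt_injOn hh (hfin.mem_toFinset.1 hx).1 (hfin.mem_toFinset.1 hy).1 hxy

/-- If an arc projection has finite rank, the spectrum in the arc consists of finitely many
eigenvalues of finite multiplicity. -/
theorem finite_of_finiteDimensional_arcProj (h0 : 0 < h) (hh : h < Real.pi)
    (hr : circlePt (φ + h) ∉ spectrum ℂ T) (hl : circlePt (φ - h) ∉ spectrum ℂ T)
    [FiniteDimensional ℂ (arcProj T φ h).range] :
    {θ ∈ Icc (φ - h) (φ + h) | circlePt θ ∈ spectrum ℂ T}.Finite ∧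
      ∀ θ ∈ Icc (φ - h) (φ + h), FiniteDimensional ℂ (eigKer T (circlePt θ)) ∧
        (circlePt θ ∈ spectrum ℂ T → eigKer T (circlePt θ) ≠ ⊥) := by
  have hnorm := isStarNormal_of_mem_unitary hT
  have hdist := dist_ne_of_notMem_spectrum hT h0 hh hr hl
  have hfd : FiniteDimensional ℂ (discProj T (circlePt φ) (2 * Real.sin (h / 2))).range :=
    inferInstanceAs (FiniteDimensional ℂ (arcProj T φ h).range)
  have hd : ∀ θ ∈ Icc (φ - h) (φ + h), dist (circlePt θ) (circlePt φ) ≤ 2 * Real.sin (h / 2) := by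
    intro θ hθ
    have hx : |θ - φ| ≤ h := abs_le.2 ⟨by linarith [hθ.1], by linarith [hθ.2]⟩
    rw [← dist_circlePt_add_le_iff (hx.trans hh.le) h0.le hh.le (φ := φ), add_sub_cancel] at hx
    exact hx
  constructor
  · have := finite_spectrum_inter_closedBall hdist
    rw [spectrum_inter_disc_eq hT h0 hh] at this
    exact this.of_finite_image fun x hx y hy hxy => circlePt_injOn hh hx.1 hy.1 hxy
  · intro θ hθ
    exact ⟨Submodule.finiteDimensional_of_le (eigKer_le_range_discProj hdist (hd θ hθ)),
      eigKer_ne_bot_of_mem_spectrum hdist (hd θ hθ)⟩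

end

end AbstractSF

end

/-! ### Motion of the spectrum along a clockwise family -/

noncomputable section

namespace AbstractSF

open Metric Set Filter Topology
open scoped ComplexConjugate

variable {X : Type*} [NormedAddCommGroup X] [InnerProductSpace ℂ X] [CompleteSpace X]

/-- An analytic family of operators, unitary on the real axis, with spectrum outside the closed
unit disc in the upper half plane, and such that `1 + U z` is Fredholm. -/
structure IsClockwiseFamily (U : ℂ → X →L[ℂ] X) (𝒰 : Set ℂ) : Prop where
  isOpen : IsOpen 𝒰
  analytic : AnalyticOnNhd ℂ U 𝒰
  fredholm : ∀ z ∈ 𝒰, (1 + U z).IsFredholm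
  unitary : ∀ t : ℝ, (t : ℂ) ∈ 𝒰 → U t ∈ unitary (X →L[ℂ] X)
  upper : ∀ z ∈ 𝒰, 0 < z.im → spectrum ℂ (U z) ⊆ {w | 1 < ‖w‖}

theorem exists_mem_spectrum_of_arcProj_ne_zero {T : X →L[ℂ] X}
    (hT : T ∈ unitary (X →L[ℂ] X)) {φ h : ℝ} (h0 : 0 < h) (hh : h < Real.pi)
    (hne : arcProj T φ h ≠ 0) : ∃ θ ∈ Icc (φ - h) (φ + h), circlePt θ ∈ spectrum ℂ T := by
  by_contra! hcon
  apply hne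
  rw [arcProj, discProj, ← cfc_zero ℂ T]
  refine cfc_congr fun z hz => ?_
  have : ¬ dist z (circlePt φ) ≤ 2 * Real.sin (h / 2) := fun hd => by
    have hmem : z ∈ {z ∈ spectrum ℂ T | dist z (circlePt φ) ≤ 2 * Real.sin (h / 2)} := ⟨hz, hd⟩
    rw [spectrum_inter_disc_eq hT h0 hh] at hmem
    obtain ⟨θ, ⟨hθ, hσ⟩, -⟩ := hmem
    exact hcon θ hθ hσ
  simp [this]

theorem two_mul_sin_half_le {h : ℝ} (h0 : 0 ≤ h) : 2 * Real.sin (h / 2) ≤ h := by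
  have := Real.sin_le (x := h / 2) (by linarith)
  linarith

theorem IsolatedIn.mono {T : X →L[ℂ] X} {w : ℂ} {ρ ρ' : ℝ} (h : IsolatedIn T w ρ) (h0 : 0 < ρ')
    (hle : ρ' ≤ ρ) : IsolatedIn T w ρ' :=
  ⟨h0, fun z hz hd => h.2 z hz (hd.trans hle)⟩

/-- If the disc through the end points of an arc isolates its centre, then the only point of the
spectrum on the arc is its centre. -/
theorem IsolatedIn.eq_of_mem_arc {T : X →L[ℂ] X} {φ h θ : ℝ} (h0 : 0 < h) (hh : h < Real.pi)
    (hiso : IsolatedIn T (circlePt φ) (2 * Real.sin (h / 2))) (hθ : θ ∈ Icc (φ - h) (φ + h))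
    (hσ : circlePt θ ∈ spectrum ℂ T) : θ = φ := by
  have hx : |θ - φ| ≤ h := abs_le.2 ⟨by linarith [hθ.1], by linarith [hθ.2]⟩
  rw [← dist_circlePt_add_le_iff (hx.trans hh.le) h0.le hh.le (φ := φ), add_sub_cancel] at hx
  exact circlePt_injOn hh hθ ⟨by linarith, by linarith⟩ (hiso.2 _ hσ hx)

namespace IsClockwiseFamily

variable {U : ℂ → X →L[ℂ] X} {𝒰 : Set ℂ} (H : IsClockwiseFamily U 𝒰) {s : ℝ}

include H

theorem eventually_mem (hs : (s : ℂ) ∈ 𝒰) : ∀ᶠ t : ℝ in 𝓝 s, (t : ℂ) ∈ 𝒰 :=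
  (Complex.continuous_ofReal.tendsto s).eventually (H.isOpen.mem_nhds hs)

theorem continuousAt (hs : (s : ℂ) ∈ 𝒰) : ContinuousAt (fun t : ℝ => U t) s :=
  (H.analytic _ hs).continuousAt.comp Complex.continuous_ofReal.continuousAt

theorem eventually_unitary (hs : (s : ℂ) ∈ 𝒰) :
    ∀ᶠ t : ℝ in 𝓝 s, U t ∈ _root_.unitary (X →L[ℂ] X) :=
  (H.eventually_mem hs).mono fun t ht => H.unitary t ht

theorem eventually_upper (hs : (s : ℂ) ∈ 𝒰) :
    ∀ᶠ η : ℝ in 𝓝[>] 0, spectrum ℂ (U (s + η * Complex.I)) ⊆ {w | 1 < ‖w‖} := by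
  have : Continuous fun η : ℝ => (s + η * Complex.I : ℂ) := by fun_prop
  have h2 := this.tendsto 0
  simp only [Complex.ofReal_zero, zero_mul, add_zero] at h2
  filter_upwards [(h2.mono_left nhdsWithin_le_nhds).eventually (H.isOpen.mem_nhds hs),
    self_mem_nhdsWithin] with η hη hpos
  exact H.upper _ hη (by simpa using hpos)

theorem eventually_notMem_spectrum (hs : (s : ℂ) ∈ 𝒰) {w : ℂ} (hw : w ∉ spectrum ℂ (U s)) :
    ∀ᶠ t : ℝ in 𝓝 s, w ∉ spectrum ℂ (U t) := by
  simp only [mem_spectrum_iff_sub, not_not] at hw ⊢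
  have : ContinuousAt (fun t : ℝ => U t - w • (1 : X →L[ℂ] X)) s :=
    (H.continuousAt hs).sub continuousAt_const
  exact this.eventually (Units.isOpen.mem_nhds hw)

/-- The rank of an arc projection is locally constant along the family. -/
theorem eventually_finrank_arcProj_eq (hs : (s : ℂ) ∈ 𝒰) {φ h : ℝ} (h0 : 0 < h)
    (hh : h < Real.pi)
    (hr : circlePt (φ + h) ∉ spectrum ℂ (U s)) (hl : circlePt (φ - h) ∉ spectrum ℂ (U s))
    [FiniteDimensional ℂ (arcProj (U s) φ h).range] :
    ∀ᶠ t : ℝ in 𝓝 s, (t : ℂ) ∈ 𝒰 ∧ circlePt (φ + h) ∉ spectrum ℂ (U t) ∧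
      circlePt (φ - h) ∉ spectrum ℂ (U t) ∧ FiniteDimensional ℂ (arcProj (U t) φ h).range ∧
      Module.finrank ℂ (arcProj (U t) φ h).range = Module.finrank ℂ (arcProj (U s) φ h).range := by
  have hU := H.unitary s hs
  have := isStarNormal_of_mem_unitary hU
  have hfd : FiniteDimensional ℂ (discProj (U s) (circlePt φ) (2 * Real.sin (h / 2))).range :=
    inferInstanceAs (FiniteDimensional ℂ (arcProj (U s) φ h).range)
  obtain ⟨η, hη, hη'⟩ := exists_finrank_discProj_eq (U s) (two_mul_sin_half_pos h0 hh)
    (dist_ne_of_notMem_spectrum hU h0 hh hr hl)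
  filter_upwards [H.eventually_mem hs, H.eventually_notMem_spectrum hs hr,
    H.eventually_notMem_spectrum hs hl,
    (H.continuousAt hs).eventually (ball_mem_nhds (U s) hη)] with t h1 h2 h3 h4
  have hUt := H.unitary t h1
  obtain ⟨h5, h6⟩ := hη' (U t) (isStarNormal_of_mem_unitary hUt)
    (dist_ne_of_notMem_spectrum hUt h0 hh h2 h3) (by rwa [← dist_eq_norm])
  exact ⟨h1, h2, h3, h5, h6⟩

/-- Small arcs around `-1` isolate `-1` from the rest of the spectrum at `s`, and carry only finite
spectral multiplicity at nearby points. -/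
theorem exists_arc (hs : (s : ℂ) ∈ 𝒰) {a : ℝ} (ha : 0 < a) : ∃ ε > 0, ε < a ∧ ε < Real.pi ∧
    (∀ θ ∈ Icc (-ε) ε, circlePt θ ∈ spectrum ℂ (U s) → θ = 0) ∧
    ∀ᶠ t : ℝ in 𝓝 s, (t : ℂ) ∈ 𝒰 ∧ circlePt ε ∉ spectrum ℂ (U t) ∧
      circlePt (-ε) ∉ spectrum ℂ (U t) ∧ FiniteDimensional ℂ (arcProj (U t) 0 ε).range := by
  have hU := H.unitary s hs
  have := isStarNormal_of_mem_unitary hU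
  obtain ⟨ρ, hρ⟩ := exists_isolatedIn_neg_one hU (H.fredholm s hs)
  have hm : 0 < min (min ρ a) Real.pi := lt_min (lt_min hρ.1 ha) Real.pi_pos
  obtain ⟨ε, hε, hε'⟩ := exists_between hm
  have hεa : ε < a := hε'.trans_le ((min_le_left _ _).trans (min_le_right _ _))
  have hερ : ε < ρ := hε'.trans_le ((min_le_left _ _).trans (min_le_left _ _))
  have hεπ : ε < Real.pi := hε'.trans_le (min_le_right _ _)
  have hiso : IsolatedIn (U s) (circlePt 0) (2 * Real.sin (ε / 2)) := by
    rw [circlePt_zero]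
    exact hρ.mono (two_mul_sin_half_pos hε hεπ) ((two_mul_sin_half_le hε.le).trans hερ.le)
  have honly : ∀ θ ∈ Icc (-ε) ε, circlePt θ ∈ spectrum ℂ (U s) → θ = 0 := fun θ hθ hσ =>
    hiso.eq_of_mem_arc hε hεπ (by simpa using hθ) hσ
  have hfd : FiniteDimensional ℂ (arcProj (U s) 0 ε).range := by
    rw [arcProj, hiso.range_discProj, circlePt_zero, eigKer_neg_one]
    exact (H.fredholm s hs).finite_ker
  have hr : circlePt ε ∉ spectrum ℂ (U s) := fun h =>
    hε.ne' (honly ε ⟨by linarith, le_rfl⟩ h)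
  have hl : circlePt (-ε) ∉ spectrum ℂ (U s) := fun h =>
    hε.ne' (neg_eq_zero.1 (honly (-ε) ⟨le_rfl, by linarith⟩ h))
  refine ⟨ε, hε, hεa, hεπ, honly, ?_⟩
  have := H.eventually_finrank_arcProj_eq hs hε hεπ (φ := 0) (by rwa [zero_add])
    (by rwa [zero_sub])
  filter_upwards [this] with t ht
  rw [zero_add, zero_sub] at ht
  exact ⟨ht.1, ht.2.1, ht.2.2.1, ht.2.2.2.1⟩

/-- An eigenvalue in an arc of finite spectral multiplicity persists nearby, and moves clockwise up
to a small error. -/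
theorem eventually_exists_near (hs : (s : ℂ) ∈ 𝒰) {ε θ : ℝ} (hε : 0 < ε) (hεπ : ε < Real.pi)
    (hr : circlePt ε ∉ spectrum ℂ (U s)) (hl : circlePt (-ε) ∉ spectrum ℂ (U s))
    [FiniteDimensional ℂ (arcProj (U s) 0 ε).range] (hθ : |θ| < ε)
    (hσ : circlePt θ ∈ spectrum ℂ (U s)) {γ β : ℝ} (hγ : 0 < γ) (hβ : 0 < β) :
    ∀ᶠ t : ℝ in 𝓝 s, t ≠ s → ∃ θ', |θ' - θ| < β ∧ circlePt θ' ∈ spectrum ℂ (U t) ∧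
      (θ' - θ) * (t - s) < γ * (t - s) ^ 2 := by
  have hU := H.unitary s hs
  have := isStarNormal_of_mem_unitary hU
  rw [← zero_add ε] at hr
  rw [← zero_sub ε] at hl
  obtain ⟨hfin, hmult⟩ := finite_of_finiteDimensional_arcProj hU hε hεπ hr hl
  have hθm : θ ∈ Icc (0 - ε) (0 + ε) := by
    rw [abs_lt] at hθ
    constructor <;> linarith
  have hfd : FiniteDimensional ℂ (eigKer (U s) (circlePt θ)) := (hmult θ hθm).1
  have hne := (hmult θ hθm).2 hσ
  have hdist : dist (circlePt θ) (circlePt 0) < 2 * Real.sin (ε / 2) := by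
    have h1 := (dist_circlePt_add_le_iff (φ := 0) (x := θ) (hθ.le.trans hεπ.le) hε.le hεπ.le).2 hθ.le
    have h2 := mt (dist_circlePt_add_eq_iff (φ := 0) (x := θ) (hθ.le.trans hεπ.le) hε.le hεπ.le).1
      hθ.ne
    rw [zero_add] at h1 h2
    exact lt_of_le_of_ne h1 h2
  obtain ⟨ρ, hρ⟩ : ∃ ρ, IsolatedIn (U s) (circlePt θ) ρ := by
    refine exists_isolatedIn_of_finite (c := circlePt 0) (r := 2 * Real.sin (ε / 2)) ?_ hdist
    rw [spectrum_inter_disc_eq hU hε hεπ]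
    exact hfin.image _
  have hD := (H.analytic s hs).differentiableAt.hasDerivAt
  obtain ⟨δ, hδ, hdini⟩ := exists_angle_mul_lt_of_eigenvector hD (H.eventually_unitary hs)
    (H.eventually_upper hs) (norm_circlePt θ) hρ hγ
  -- Half-length below four thresholds: isolation of the eigenvalue, the required closeness `β`, the
  -- range of the Dini estimate, and `π`.
  obtain ⟨h, hh0, hh⟩ := exists_between (lt_min (lt_min hρ.1 hβ) (lt_min hδ Real.pi_pos))
  have hhρ : h < ρ := hh.trans_le ((min_le_left _ _).trans (min_le_left _ _))
  have hhβ : h < β := hh.trans_le ((min_le_left _ _).trans (min_le_right _ _))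
  have hhδ : h < δ := hh.trans_le ((min_le_right _ _).trans (min_le_left _ _))
  have hhπ : h < Real.pi := hh.trans_le ((min_le_right _ _).trans (min_le_right _ _))
  have hiso : IsolatedIn (U s) (circlePt θ) (2 * Real.sin (h / 2)) :=
    hρ.mono (two_mul_sin_half_pos hh0 hhπ) ((two_mul_sin_half_le hh0.le).trans hhρ.le)
  have hrange : (arcProj (U s) θ h).range = eigKer (U s) (circlePt θ) := hiso.range_discProj
  have hfd' : FiniteDimensional ℂ (arcProj (U s) θ h).range := by rwa [hrange]
  have hr' : circlePt (θ + h) ∉ spectrum ℂ (U s) := fun hm =>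
    hh0.ne' (by linarith [hiso.eq_of_mem_arc hh0 hhπ ⟨by linarith, le_rfl⟩ hm])
  have hl' : circlePt (θ - h) ∉ spectrum ℂ (U s) := fun hm =>
    hh0.ne' (by linarith [hiso.eq_of_mem_arc hh0 hhπ ⟨le_rfl, by linarith⟩ hm])
  filter_upwards [H.eventually_finrank_arcProj_eq hs hh0 hhπ hr' hl', ball_mem_nhds s hδ]
    with t ⟨ht, hrt, hlt, hfdt, hrank⟩ htδ hts
  have hUt := H.unitary t ht
  have hnt := isStarNormal_of_mem_unitary hUt
  -- Persistence: the rank at `t` equals the multiplicity at `s`, which is positive.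
  have hpos : 0 < Module.finrank ℂ (arcProj (U t) θ h).range := by
    rw [hrank, hrange]
    exact Module.finrank_pos_iff.2 (Submodule.nontrivial_iff_ne_bot.2 hne)
  have hne0 : arcProj (U t) θ h ≠ 0 := by
    intro h0
    rw [h0] at hpos
    have : LinearMap.range ((0 : X →L[ℂ] X) : X →ₗ[ℂ] X) = ⊥ := LinearMap.range_zero
    rw [this, finrank_bot] at hpos
    exact hpos.ne rfl
  obtain ⟨θ', hθ', hσ'⟩ := exists_mem_spectrum_of_arcProj_ne_zero hUt hh0 hhπ hne0
  have hne' := ((finite_of_finiteDimensional_arcProj hUt hh0 hhπ hrt hlt).2 θ' hθ').2 hσ'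
  have habs : |θ' - θ| ≤ h := abs_le.2 ⟨by linarith [hθ'.1], by linarith [hθ'.2]⟩
  refine ⟨θ', habs.trans_lt hhβ, hσ', hdini t hts (by rwa [← Real.dist_eq]) _
    (habs.trans_lt hhδ) ?_⟩
  rwa [← circlePt_add, add_sub_cancel]

/-- Non-invertibility is a closed condition on the operator, which depends continuously on time and
angle; this supplies the closedness needed for `notMem_of_moves_clockwise`. -/
theorem isClosed_spectrum_inter {K : Set (ℝ × ℝ)} (hK : IsClosed K)
    (hmem : ∀ p ∈ K, (p.1 : ℂ) ∈ 𝒰) :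
    IsClosed ({p : ℝ × ℝ | circlePt p.2 ∈ spectrum ℂ (U p.1)} ∩ K) := by
  have hcont : ContinuousOn (fun p : ℝ × ℝ => U p.1 - circlePt p.2 • (1 : X →L[ℂ] X)) K := by
    intro p hp
    have h1 : ContinuousAt (fun p : ℝ × ℝ => U p.1) p :=
      ContinuousAt.comp (f := Prod.fst) (g := fun t : ℝ => U t) (H.continuousAt (hmem p hp))
        continuousAt_fst
    have h2 : ContinuousAt (fun p : ℝ × ℝ => circlePt p.2 • (1 : X →L[ℂ] X)) p :=
      ((continuous_circlePt.comp continuous_snd).smul continuous_const).continuousAt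
    exact (h1.sub h2).continuousWithinAt
  have := hcont.preimage_isClosed_of_isClosed hK
    (Units.isOpen (R := X →L[ℂ] X)).isClosed_compl
  rw [inter_comm]
  convert! this using 2
  ext p
  simp only [mem_ofPred_eq, mem_spectrum_iff_sub, mem_preimage, mem_compl_iff]

/-- Near `s`, the spectrum close to `-1` lies on the clockwise side after `s` and on the
counterclockwise side before `s`. -/
theorem eventually_notMem_spectrum_arc {ε : ℝ} (hε : 0 < ε)
    (hεπ : ε < Real.pi) (honly : ∀ θ ∈ Icc (-ε) ε, circlePt θ ∈ spectrum ℂ (U s) → θ = 0)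
    (hev : ∀ᶠ t : ℝ in 𝓝 s, (t : ℂ) ∈ 𝒰 ∧ circlePt ε ∉ spectrum ℂ (U t) ∧
      circlePt (-ε) ∉ spectrum ℂ (U t) ∧ FiniteDimensional ℂ (arcProj (U t) 0 ε).range) :
    ∀ᶠ t : ℝ in 𝓝 s, (s < t → ∀ θ ∈ Ioc 0 ε, circlePt θ ∉ spectrum ℂ (U t)) ∧
      (t < s → ∀ θ ∈ Ico (-ε) 0, circlePt θ ∉ spectrum ℂ (U t)) := by
  obtain ⟨δ, hδ, hgood⟩ := Metric.eventually_nhds_iff.1 hev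
  filter_upwards [ball_mem_nhds s hδ] with t₁ ht₁
  rw [mem_ball, Real.dist_eq, abs_lt] at ht₁
  have hgood' : ∀ t, -δ < t - s → t - s < δ → (t : ℂ) ∈ 𝒰 ∧ circlePt ε ∉ spectrum ℂ (U t) ∧
      circlePt (-ε) ∉ spectrum ℂ (U t) ∧ FiniteDimensional ℂ (arcProj (U t) 0 ε).range :=
    fun t h1 h2 => hgood (by rw [Real.dist_eq, abs_lt]; exact ⟨h1, h2⟩)
  constructor
  · intro hst
    refine notMem_of_moves_clockwise
      (S := {p : ℝ × ℝ | circlePt p.2 ∈ spectrum ℂ (U p.1)}) hst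
      (H.isClosed_spectrum_inter (isClosed_Icc.prod isClosed_Icc) ?_) ?_ ?_
    · rintro ⟨t, θ⟩ ⟨ht, -⟩
      exact (hgood' t (by linarith [ht.1]) (by linarith [ht.2])).1
    · intro θ hθ hσ
      exact hθ.1.ne' (honly θ ⟨by linarith [hθ.1], hθ.2⟩ hσ)
    · intro t ht θ hθ hσ γ hγ
      obtain ⟨h1, h2, h3, h4⟩ := hgood' t (by linarith [ht.1]) (by linarith [ht.2])
      have hθε : θ < ε := lt_of_le_of_ne hθ.2 (by rintro rfl; exact h2 hσ)
      -- The window `min θ (ε - θ)` keeps the neighbouring angle in `[0, ε]`. For `t' < t`, dividing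
      -- by `t' - t < 0` turns the Dini estimate into the lower bound required on `θ'`.
      have hnear := H.eventually_exists_near h1 hε hεπ h2 h3
        (abs_lt.2 ⟨by linarith [hθ.1], hθε⟩) hσ hγ (lt_min hθ.1 (sub_pos.2 hθε))
      obtain ⟨t', ht', hlt⟩ := ((hnear.filter_mono nhdsWithin_le_nhds).and
        (Ico_mem_nhdsLT ht.1)).exists
      obtain ⟨θ', hθ', hσ', hle⟩ := ht' hlt.2.ne
      obtain ⟨h5, h6⟩ := abs_lt.1 hθ'
      have h7 := min_le_left θ (ε - θ)
      have h8 := min_le_right θ (ε - θ)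
      refine ⟨t', hlt, θ', ⟨by linarith, by linarith⟩, hσ', ?_⟩
      have h9 : 0 < t - t' := sub_pos.2 hlt.2
      nlinarith
  · intro hts
    -- Reversing both time and angle preserves clockwise motion, so the situation before `s` reduces
    -- to the one after.
    have key := notMem_of_moves_clockwise
      (S := {p : ℝ × ℝ | circlePt (-p.2) ∈ spectrum ℂ (U ((-p.1 : ℝ) : ℂ))}) (s := -s) (t₁ := -t₁)
      (ε := ε) (by linarith) ?_ ?_ ?_
    · intro θ hθ hσ
      refine key (-θ) ⟨by linarith [hθ.2], by linarith [hθ.1]⟩ ?_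
      simpa using hσ
    · have h1 := H.isClosed_spectrum_inter (K := Icc t₁ s ×ˢ Icc (-ε) 0)
        (isClosed_Icc.prod isClosed_Icc) (by
          rintro ⟨t, θ⟩ ⟨ht, -⟩
          exact (hgood' t (by linarith [ht.1]) (by linarith [ht.2])).1)
      have h2 := h1.preimage (f := fun p : ℝ × ℝ => (-p.1, -p.2)) (by fun_prop)
      convert! h2 using 1
      ext ⟨t, θ⟩
      simp only [mem_inter_iff, mem_ofPred_eq, mem_prod, mem_Icc, mem_preimage, neg_le_neg_iff,
        Left.neg_nonpos_iff]
      refine and_congr Iff.rfl ⟨fun h => ⟨⟨by linarith, by linarith⟩, by linarith, by linarith⟩,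
        fun h => ⟨⟨by linarith, by linarith⟩, by linarith, by linarith⟩⟩
    · intro θ hθ hσ
      simp only [mem_ofPred_eq, neg_neg] at hσ
      exact hθ.1.ne' (neg_eq_zero.1 (honly (-θ) ⟨by linarith [hθ.2], by linarith [hθ.1]⟩ hσ))
    · intro t ht θ hθ hσ γ hγ
      simp only [mem_ofPred_eq] at hσ
      obtain ⟨h1, h2, h3, h4⟩ := hgood' (-t) (by linarith [ht.2]) (by linarith [ht.1])
      have hθε : θ < ε := lt_of_le_of_ne hθ.2 (by rintro rfl; exact h3 hσ)
      have hnear := H.eventually_exists_near h1 hε hεπ h2 h3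
        (abs_lt.2 ⟨by linarith [hθ.1], by linarith [hθ.1]⟩) hσ hγ (lt_min hθ.1 (sub_pos.2 hθε))
      obtain ⟨t', ht', hlt⟩ := ((hnear.filter_mono nhdsWithin_le_nhds).and
        (Ioc_mem_nhdsGT (show -t < s by linarith [ht.1]))).exists
      obtain ⟨θ', hθ', hσ', hle⟩ := ht' hlt.1.ne'
      obtain ⟨h5, h6⟩ := abs_lt.1 hθ'
      have h7 := min_le_left θ (ε - θ)
      have h8 := min_le_right θ (ε - θ)
      refine ⟨-t', ⟨by linarith [hlt.2], by linarith [hlt.1]⟩, -θ', ⟨by linarith, by linarith⟩,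
        by simpa using hσ', ?_⟩
      have h9 : 0 < t' - -t := sub_pos.2 hlt.1
      nlinarith

end IsClockwiseFamily

end AbstractSF

end

/-! ### Isolation in time of the eigenvalue `-1` -/

noncomputable section

namespace AbstractSF

open Metric Set Filter Topology

variable {X : Type*} [NormedAddCommGroup X] [InnerProductSpace ℂ X] [CompleteSpace X]

theorem discProj_mul_discInv {T : X →L[ℂ] X} {c w : ℂ} {r : ℝ}
    (h : ∀ z ∈ spectrum ℂ T, dist z c ≠ r) (hw : dist w c ≤ r) :
    discProj T c r * discInv T c r w = 0 := by
  rw [discProj, discInv, ← cfc_mul _ _ T (continuousOn_proj_fun h) (continuousOn_inv_fun h hw),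
    ← cfc_zero ℂ T]
  congr 1
  ext z
  split_ifs <;> simp

/-- The inverse is `B + P`: `B` inverts `T - w` off the eigenspace, and `P` is the identity on it.
-/
theorem IsolatedIn.isUnit_sub_add_discProj {T : X →L[ℂ] X} [IsStarNormal T] {w : ℂ} {ρ : ℝ}
    (h : IsolatedIn T w ρ) : IsUnit (T - w • 1 + discProj T w ρ) := by
  have hd : dist w w ≤ ρ := by simpa using h.1.le
  set N := T - w • (1 : X →L[ℂ] X) with hN
  set P := discProj T w ρ with hP
  set B := discInv T w ρ w with hB
  have hNP : N * P = 0 := h.sub_mul_discProj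
  have hPN : P * N = 0 := by rw [← hNP, hP, commute_discProj_sub.eq]
  have hPP : P * P = P := discProj_mul_self h.dist_ne
  have hPB : P * B = 0 := discProj_mul_discInv h.dist_ne hd
  have hBP : B * P = 0 := by
    rw [← hPB]
    exact cfc_commute_cfc _ _ _
  have hNB : N * B = 1 - P := sub_mul_discInv h.dist_ne hd
  have hBN : B * N = 1 - P := discInv_mul_sub h.dist_ne hd
  refine ⟨⟨N + P, B + P, ?_, ?_⟩, rfl⟩
  · rw [add_mul, mul_add, mul_add, hNB, hNP, hPB, hPP]
    abel
  · rw [add_mul, mul_add, mul_add, hBN, hBP, hPN, hPP]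
    abel

theorem analyticAt_linearMap_det {E : Type*} [AddCommGroup E] [Module ℂ E] [FiniteDimensional ℂ E]
    {A : ℂ → E →ₗ[ℂ] E} {s : ℂ}
    (hA : ∀ (v : E) (l : E →ₗ[ℂ] ℂ), AnalyticAt ℂ (fun z => l (A z v)) s) :
    AnalyticAt ℂ (fun z => LinearMap.det (A z)) s := by
  let b := Module.finBasis ℂ E
  have : (fun z => LinearMap.det (A z)) = fun z => ∑ σ : Equiv.Perm (Fin (Module.finrank ℂ E)),
      (Equiv.Perm.sign σ : ℂ) * ∏ i, b.coord (σ i) (A z (b i)) := by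
    funext z
    rw [← LinearMap.det_toMatrix b, Matrix.det_apply']
    simp [LinearMap.toMatrix_apply]
  rw [this]
  refine Finset.analyticAt_fun_sum _ fun σ _ => analyticAt_const.mul ?_
  exact Finset.analyticAt_fun_prod _ fun i _ => hA _ _

/-- In an analytic family of operators, an isolated eigenvalue of finite multiplicity equal to `w`
at `s` occurs as an eigenvalue nearby either only at `s` or at every point. -/
theorem eventually_eigKer_eq_bot_of_frequently {U : ℂ → X →L[ℂ] X} {s : ℂ}
    (hU : AnalyticAt ℂ U s) [IsStarNormal (U s)] {w : ℂ} {ρ : ℝ} (h : IsolatedIn (U s) w ρ)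
    [FiniteDimensional ℂ (eigKer (U s) w)]
    (hfreq : ∃ᶠ z in 𝓝 s, w ∉ spectrum ℂ (U z)) :
    ∀ᶠ z in 𝓝[≠] s, eigKer (U z) w = ⊥ := by
  set P := discProj (U s) w ρ with hP
  set E := eigKer (U s) w with hE
  have hPE : ∀ v, P v ∈ E := fun v => by
    rw [hE, ← h.range_discProj]
    exact ⟨v, rfl⟩
  let P' : X →ₗ[ℂ] E := (P : X →ₗ[ℂ] X).codRestrict E hPE
  have hP'v : ∀ v, ((P' v : E) : X) = P v := fun _ => rfl
  set K : ℂ → X →L[ℂ] X := fun z => U z - w • 1 + P with hK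
  have hKan : AnalyticAt ℂ K s := (hU.sub analyticAt_const).add analyticAt_const
  have hKs : IsUnit (K s) := h.isUnit_sub_add_discProj
  have hKunit : ∀ᶠ z in 𝓝 s, IsUnit (K z) :=
    hKan.continuousAt.eventually (Units.isOpen.mem_nhds hKs)
  have hGan : AnalyticAt ℂ (fun z => Ring.inverse (K z)) s := by
    obtain ⟨k, hk⟩ := hKs
    have := analyticAt_inverse (𝕜 := ℂ) k
    rw [hk] at this
    exact this.comp hKan
  -- From `U z - w = K z - P = K z (1 - (K z)⁻¹ P)`, the kernel of `U z - w` corresponds to that of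
  -- `1 - P (K z)⁻¹` on the fixed finite-dimensional space `E`, whose determinant is analytic in
  -- `z`.
  let A : ℂ → E →ₗ[ℂ] E := fun z =>
    LinearMap.id - (P' ∘ₗ ((Ring.inverse (K z) : X →L[ℂ] X) : X →ₗ[ℂ] X)) ∘ₗ E.subtype
  have hAv : ∀ z (v : E), A z v = v - P' (Ring.inverse (K z) v) := fun _ _ => rfl
  have hdet : AnalyticAt ℂ (fun z => LinearMap.det (A z)) s := by
    refine analyticAt_linearMap_det fun v l => ?_
    simp only [hAv, map_sub]
    refine analyticAt_const.sub ?_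
    let L : X →L[ℂ] ℂ :=
      (LinearMap.toContinuousLinearMap l).comp ((P : X →L[ℂ] X).codRestrict E hPE)
    exact ((L.comp (ContinuousLinearMap.apply ℂ X (v : X))).analyticAt _).comp hGan
  have hker : ∀ z, IsUnit (K z) → (LinearMap.det (A z) = 0 ↔ eigKer (U z) w ≠ ⊥) := by
    intro z hz
    have hKG : ∀ v, K z (Ring.inverse (K z) v) = v := fun v => by
      rw [← mul_apply_eq_comp, Ring.mul_inverse_cancel _ hz]
      rfl
    have hGK : ∀ v, Ring.inverse (K z) (K z v) = v := fun v => by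
      rw [← mul_apply_eq_comp, Ring.inverse_mul_cancel _ hz]
      rfl
    rw [LinearMap.det_eq_zero_iff_ker_ne_bot, Submodule.ne_bot_iff, Submodule.ne_bot_iff]
    constructor
    · rintro ⟨v, hv, hv0⟩
      rw [LinearMap.mem_ker, hAv, sub_eq_zero] at hv
      have hPv : P (Ring.inverse (K z) v) = v := (congrArg Subtype.val hv).symm
      refine ⟨Ring.inverse (K z) v, ?_, fun h0 => hv0 ?_⟩
      · have h1 := hKG v
        rw [hK, add_apply, hPv] at h1
        exact add_eq_right.1 h1
      · rw [h0, map_zero] at hPv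
        exact Subtype.ext hPv.symm
    · rintro ⟨x, hx, hx0⟩
      have hx' : (U z - w • 1) x = 0 := hx
      have hKx : K z x = P x := by rw [hK, add_apply, hx', zero_add]
      have hGP : Ring.inverse (K z) (P x) = x := by rw [← hKx, hGK]
      refine ⟨P' x, ?_, fun h0 => hx0 ?_⟩
      · rw [LinearMap.mem_ker, hAv, sub_eq_zero, hP'v, hGP]
      · have : P x = 0 := by rw [← hP'v, h0]; rfl
        rw [← hGP, this, map_zero]
  -- Identical vanishing near `s` would make `w` an eigenvalue at all nearby `z`, against `hfreq`.
  rcases hdet.eventually_eq_zero_or_eventually_ne_zero with h0 | h0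
  · exfalso
    obtain ⟨z, hz, hz0, hzK⟩ := (hfreq.and_eventually (h0.and hKunit)).exists
    exact (hker z hzK).1 hz0 (eigKer_eq_bot_of_notMem hz)
  · filter_upwards [h0, hKunit.filter_mono nhdsWithin_le_nhds] with z hz hzK
    by_contra hne
    exact hz ((hker z hzK).2 hne)

/-- The nearby points without spectrum at `-1` are `s + iη` with `η > 0`, where the spectrum lies
outside the closed unit disc. Analyticity carries the conclusion back to the real axis. -/
theorem IsClockwiseFamily.eventually_eigKer_eq_bot {U : ℂ → X →L[ℂ] X} {𝒰 : Set ℂ}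
    (H : IsClockwiseFamily U 𝒰) {s : ℝ} (hs : (s : ℂ) ∈ 𝒰) :
    ∀ᶠ t : ℝ in 𝓝[≠] s, eigKer (U t) (-1) = ⊥ := by
  have hU := H.unitary s hs
  have hn := isStarNormal_of_mem_unitary hU
  obtain ⟨ρ, hρ⟩ := exists_isolatedIn_neg_one hU (H.fredholm s hs)
  have hfd : FiniteDimensional ℂ (eigKer (U s) (-1)) := by
    rw [eigKer_neg_one]
    exact (H.fredholm s hs).finite_ker
  have h1 := eventually_eigKer_eq_bot_of_frequently (H.analytic s hs) hρ (by
    have hcont : Continuous fun η : ℝ => (s + η * Complex.I : ℂ) := by fun_prop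
    have h2 := hcont.tendsto 0
    simp only [Complex.ofReal_zero, zero_mul, add_zero] at h2
    refine (h2.mono_left nhdsWithin_le_nhds).frequently
      (Eventually.frequently (f := 𝓝[>] (0 : ℝ)) ?_)
    filter_upwards [H.eventually_upper hs] with η hη hmem
    have := hη hmem
    simp at this)
  have htend : Tendsto (fun t : ℝ => (t : ℂ)) (𝓝[≠] s) (𝓝[≠] (s : ℂ)) :=
    tendsto_nhdsWithin_of_tendsto_nhds_of_eventually_within _
      ((Complex.continuous_ofReal.tendsto s).mono_left nhdsWithin_le_nhds)
      (by filter_upwards [self_mem_nhdsWithin] with t ht; simpa using ht)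
  exact htend.eventually h1

end AbstractSF

end

/-! ### Arc counts and the spectral flow -/

noncomputable section

namespace AbstractSF

open Metric Set Filter Topology

variable {X : Type*} [NormedAddCommGroup X] [InnerProductSpace ℂ X]

/-- Conditions of `FlowPartition` on a single subinterval: along `J`, the spectrum avoids the
counterclockwise end point of the arc of half-length `ε` around `-1`, and is discrete of finite
multiplicity on this arc. -/
structure ArcAdmissible (W : ℝ → X →L[ℂ] X) (J : Set ℝ) (ε : ℝ) : Prop where
  notMem_right : ∀ t ∈ J, circlePt ε ∉ spectrum ℂ (W t)
  finite_spectrum : ∀ t ∈ J, {θ ∈ Icc (-ε) ε | circlePt θ ∈ spectrum ℂ (W t)}.Finite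
  finite_mult : ∀ t ∈ J, ∀ θ ∈ Icc (-ε) ε, FiniteDimensional ℂ (eigKer (W t) (circlePt θ))

/-- The multiplicity of the eigenvalue `circlePt θ`. -/
def arcMult (T : X →L[ℂ] X) (θ : ℝ) : ℕ := Module.finrank ℂ (eigKer T (circlePt θ))

theorem arcCount_eq (T : X →L[ℂ] X) (ε : ℝ) : arcCount T ε = ∑ᶠ θ ∈ Icc 0 ε, arcMult T θ := rfl

theorem arcMult_eq_zero {T : X →L[ℂ] X} {θ : ℝ} (h : circlePt θ ∉ spectrum ℂ T) :
    arcMult T θ = 0 := by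
  rw [arcMult, eigKer_eq_bot_of_notMem h, finrank_bot]

theorem arcMult_zero (T : X →L[ℂ] X) : arcMult T 0 = Module.finrank ℂ (eigKer T (-1)) := by
  rw [arcMult, circlePt_zero]

/-- The number of eigenvalues with angle in a set does not change if angles that are not
eigenvalues are removed or added. -/
theorem finsum_arcMult_congr {T : X →L[ℂ] X} {A B : Set ℝ}
    (h : ∀ θ, arcMult T θ ≠ 0 → (θ ∈ A ↔ θ ∈ B)) :
    ∑ᶠ θ ∈ A, arcMult T θ = ∑ᶠ θ ∈ B, arcMult T θ :=
  finsum_mem_inter_support_eq' _ _ _ fun θ hθ => h θ hθ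

namespace IsClockwiseFamily

variable [CompleteSpace X] {U : ℂ → X →L[ℂ] X} {𝒰 : Set ℂ} (H : IsClockwiseFamily U 𝒰) {s : ℝ}

include H

/-- The number of eigenvalues in a subarc with end points off the spectrum is locally constant. -/
theorem eventually_finsum_arcMult_eq {J : Set ℝ} {ε : ℝ}
    (hJ : ArcAdmissible (fun t : ℝ => U t) J ε) (hs : s ∈ J) (hs𝒰 : (s : ℂ) ∈ 𝒰)
    {a b : ℝ} (hab : a < b) (hba : b - a < 2 * Real.pi) (ha : -ε ≤ a) (hb : b ≤ ε)
    (has : circlePt a ∉ spectrum ℂ (U s)) (hbs : circlePt b ∉ spectrum ℂ (U s)) :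
    ∀ᶠ t : ℝ in 𝓝[J] s, ∑ᶠ θ ∈ Icc a b, arcMult (U t) θ = ∑ᶠ θ ∈ Icc a b, arcMult (U s) θ := by
  have h0 : 0 < (b - a) / 2 := by linarith
  have hh : (b - a) / 2 < Real.pi := by linarith
  have e1 : (a + b) / 2 - (b - a) / 2 = a := by ring
  have e2 : (a + b) / 2 + (b - a) / 2 = b := by ring
  have hsub : Icc a b ⊆ Icc (-ε) ε := Icc_subset_Icc ha hb
  have key : ∀ t ∈ J, U t ∈ _root_.unitary (X →L[ℂ] X) → circlePt a ∉ spectrum ℂ (U t) →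
      circlePt b ∉ spectrum ℂ (U t) →
      FiniteDimensional ℂ (arcProj (U t) ((a + b) / 2) ((b - a) / 2)).range ∧
        ∑ᶠ θ ∈ Icc a b, arcMult (U t) θ =
          Module.finrank ℂ (arcProj (U t) ((a + b) / 2) ((b - a) / 2)).range := by
    intro t ht hUt hat hbt
    have := finsum_finrank_eigKer_eq hUt (φ := (a + b) / 2) h0 hh
    rw [e1, e2] at this
    exact this hbt hat ((hJ.finite_spectrum t ht).subset fun θ hθ => ⟨hsub hθ.1, hθ.2⟩)
      fun θ hθ => hJ.finite_mult t ht θ (hsub hθ)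
  obtain ⟨hfd, hrank⟩ := key s hs (H.unitary s hs𝒰) has hbs
  have hev := H.eventually_finrank_arcProj_eq hs𝒰 (φ := (a + b) / 2) h0 hh
    (by rwa [e2]) (by rwa [e1])
  rw [e1, e2] at hev
  filter_upwards [hev.filter_mono nhdsWithin_le_nhds, self_mem_nhdsWithin]
    with t ⟨ht, hbt, hat, _, hr⟩ htJ
  rw [(key t htJ (H.unitary t ht) hat hbt).2, hr, hrank]

/-- The arc count drops by the multiplicity of `-1` immediately after `s`, and is left-continuous. -/
theorem eventually_arcCount {J : Set ℝ} {ε : ℝ} (hε : 0 < ε) (hεπ : ε < Real.pi)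
    (hJ : ArcAdmissible (fun t : ℝ => U t) J ε) (hs : s ∈ J) (hs𝒰 : (s : ℂ) ∈ 𝒰) :
    ∀ᶠ t : ℝ in 𝓝[J] s, (s < t → arcCount (U t) ε + arcMult (U s) 0 = arcCount (U s) ε) ∧
      (t < s → arcCount (U t) ε = arcCount (U s) ε) := by
  obtain ⟨ε₀, hε₀, hlt, -, honly, hev⟩ := H.exists_arc hs𝒰 (lt_min hε (sub_pos.2 hεπ))
  have hε₀ε : ε₀ < ε := hlt.trans_le (min_le_left _ _)
  have hε₀π : ε₀ < Real.pi - ε := hlt.trans_le (min_le_right _ _)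
  obtain ⟨-, hr₀, hl₀, -⟩ := hev.self_of_nhds
  have hR := H.eventually_finsum_arcMult_eq hJ hs hs𝒰 hε₀ε (by linarith [Real.pi_pos])
    (by linarith) le_rfl hr₀ (hJ.notMem_right s hs)
  have hL := H.eventually_finsum_arcMult_eq hJ hs hs𝒰 (a := -ε₀) (b := ε) (by linarith)
    (by linarith [Real.pi_pos]) (by linarith) le_rfl hl₀ (hJ.notMem_right s hs)
  have hclock := H.eventually_notMem_spectrum_arc hε₀ (by linarith) honly hev
  have hker : ∀ᶠ t : ℝ in 𝓝 s, t ≠ s → eigKer (U t) (-1) = ⊥ :=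
    eventually_nhdsWithin_iff.1 (H.eventually_eigKer_eq_bot hs𝒰)
  filter_upwards [hR, hL, hclock.filter_mono nhdsWithin_le_nhds,
    hker.filter_mono nhdsWithin_le_nhds] with t h1 h2 ⟨h3, h4⟩ h5
  have hzero : t ≠ s → arcMult (U t) 0 = 0 := fun hts => by
    rw [arcMult_zero, h5 hts, finrank_bot]
  have hs0 : ∀ θ ∈ Icc (-ε₀) ε₀, arcMult (U s) θ ≠ 0 → θ = 0 := fun θ hθ hne => by
    by_contra h0
    exact hne (arcMult_eq_zero fun hσ => h0 (honly θ hθ hσ))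
  constructor
  · intro hst
    -- After `s`, no eigenvalue has angle in `[0, ε₀]`: what was at `-1` has left clockwise. The
    -- count on `[ε₀, ε]` is locally constant and at `s` misses exactly `-1`.
    have e1 : arcCount (U t) ε = ∑ᶠ θ ∈ Icc ε₀ ε, arcMult (U t) θ := by
      rw [arcCount_eq]
      refine finsum_arcMult_congr fun θ hne =>
        ⟨fun hθ => ⟨?_, hθ.2⟩, fun hθ => ⟨hε₀.le.trans hθ.1, hθ.2⟩⟩
      by_contra! hlt'
      rcases hθ.1.eq_or_lt with rfl | hpos
      · exact hne (hzero hst.ne')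
      · exact hne (arcMult_eq_zero (h3 hst θ ⟨hpos, hlt'.le⟩))
    have e2 : arcCount (U s) ε = arcMult (U s) 0 + ∑ᶠ θ ∈ Icc ε₀ ε, arcMult (U s) θ := by
      rw [arcCount_eq, ← finsum_mem_insert' _ (fun h => hε₀.not_ge h.1)]
      · refine finsum_arcMult_congr fun θ hne => ⟨fun hθ => ?_, ?_⟩
        · by_contra hnm
          rw [mem_insert_iff, not_or] at hnm
          have : θ < ε₀ := not_le.1 fun h => hnm.2 ⟨h, hθ.2⟩
          exact hnm.1 (hs0 θ ⟨by linarith [hθ.1], this.le⟩ hne)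
        · rintro (rfl | hθ)
          · exact ⟨le_rfl, hε.le⟩
          · exact ⟨hε₀.le.trans hθ.1, hθ.2⟩
      · refine (hJ.finite_spectrum s hs).subset fun θ hθ => ⟨⟨by linarith [hθ.1.1], hθ.1.2⟩, ?_⟩
        by_contra hns
        exact hθ.2 (arcMult_eq_zero hns)
    rw [e1, e2, h1, add_comm]
  · intro hts
    -- Before `s`, no eigenvalue has angle in `[-ε₀, 0)`, so the count may be taken on `[-ε₀, ε]`,
    -- where it is locally constant and at `s` includes `-1`.
    have e1 : arcCount (U t) ε = ∑ᶠ θ ∈ Icc (-ε₀) ε, arcMult (U t) θ := by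
      rw [arcCount_eq]
      refine finsum_arcMult_congr fun θ hne =>
        ⟨fun hθ => ⟨by linarith [hθ.1], hθ.2⟩, fun hθ => ⟨?_, hθ.2⟩⟩
      by_contra! hlt'
      exact hne (arcMult_eq_zero (h4 hts θ ⟨hθ.1, hlt'⟩))
    have e2 : arcCount (U s) ε = ∑ᶠ θ ∈ Icc (-ε₀) ε, arcMult (U s) θ := by
      rw [arcCount_eq]
      refine finsum_arcMult_congr fun θ hne =>
        ⟨fun hθ => ⟨by linarith [hθ.1], hθ.2⟩, fun hθ => ⟨?_, hθ.2⟩⟩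
      by_contra! hlt'
      exact hlt'.ne (hs0 θ ⟨hθ.1, by linarith⟩ hne)
    rw [e1, e2, h2]

/-- An infinite set of such times would accumulate in the compact interval, against isolation at the
accumulation point. -/
theorem finite_setOf_eigKer_ne_bot {a b : ℝ} (hab : ∀ t ∈ Icc a b, (t : ℂ) ∈ 𝒰) :
    {t ∈ Icc a b | eigKer (U t) (-1) ≠ ⊥}.Finite := by
  by_contra hinf
  obtain ⟨x, hx, hacc⟩ := Set.Infinite.exists_accPt_of_subset_isCompact hinf
    (isCompact_Icc (a := a) (b := b)) (sep_subset _ _)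
  rw [accPt_iff_frequently_nhdsNE] at hacc
  obtain ⟨t, ht, ht'⟩ := (hacc.and_eventually (H.eventually_eigKer_eq_bot (hab x hx))).exists
  exact ht.2 ht'

/-- Along an interval on which an arc is admissible, the arc count drops by the total multiplicity
of the eigenvalue `-1`. -/
theorem arcCount_add_finsum {a b ε : ℝ} (hab : a ≤ b) (hmem : ∀ t ∈ Icc a b, (t : ℂ) ∈ 𝒰)
    (hε : 0 < ε) (hεπ : ε < Real.pi) (hJ : ArcAdmissible (fun t : ℝ => U t) (Icc a b) ε) :
    arcCount (U b) ε + ∑ᶠ u ∈ Ico a b, arcMult (U u) 0 = arcCount (U a) ε := by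
  have hfin : (Icc a b ∩ Function.support fun u : ℝ => arcMult (U u) 0).Finite := by
    refine (H.finite_setOf_eigKer_ne_bot hmem).subset fun u hu => ⟨hu.1, fun h0 => hu.2 ?_⟩
    change arcMult (U u) 0 = 0
    rw [arcMult_zero, h0, finrank_bot]
  -- The half-open interval matches the left-continuous count: the multiplicity at `s` enters the
  -- sum just after `s`, exactly when the count loses it.
  set g : ℝ → ℕ := fun t => arcCount (U t) ε + ∑ᶠ u ∈ Ico a t, arcMult (U u) 0 with hg
  have hcont : ContinuousOn g (Icc a b) := by
    intro s hs
    have hs𝒰 := hmem s hs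
    have hker : ∀ᶠ t : ℝ in 𝓝[≠] s, arcMult (U t) 0 = 0 := by
      filter_upwards [H.eventually_eigKer_eq_bot hs𝒰] with t ht
      rw [arcMult_zero, ht, finrank_bot]
    rw [eventually_nhdsWithin_iff] at hker
    obtain ⟨δ, hδ, hδ'⟩ := Metric.eventually_nhds_iff.1 hker
    refine ContinuousWithinAt.congr_of_eventuallyEq continuousWithinAt_const ?_ rfl
    filter_upwards [H.eventually_arcCount hε hεπ hJ hs hs𝒰, self_mem_nhdsWithin,
      mem_nhdsWithin_of_mem_nhds (ball_mem_nhds s hδ)] with t ⟨h1, h2⟩ ht htδ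
    rw [mem_ball, Real.dist_eq, abs_lt] at htδ
    have hnear : ∀ u, u ≠ s → -δ < u - s → u - s < δ → arcMult (U u) 0 = 0 := fun u hu h3 h4 =>
      hδ' (by rw [Real.dist_eq, abs_lt]; exact ⟨h3, h4⟩) hu
    rcases lt_trichotomy s t with hst | rfl | hts
    · have e : ∑ᶠ u ∈ Ico a t, arcMult (U u) 0
          = arcMult (U s) 0 + ∑ᶠ u ∈ Ico a s, arcMult (U u) 0 := by
        rw [← finsum_mem_insert' (fun u : ℝ => arcMult (U u) 0) (fun h => h.2.false)
          (hfin.subset (inter_subset_inter_left _ fun u hu => ⟨hu.1, hu.2.le.trans hs.2⟩))]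
        refine finsum_mem_inter_support_eq' _ _ _ fun u hu => ⟨fun hut => ?_, ?_⟩
        · by_contra hnm
          rw [mem_insert_iff, not_or] at hnm
          have h3 : s ≤ u := not_lt.1 fun h => hnm.2 ⟨hut.1, h⟩
          exact hu (hnear u hnm.1 (by linarith) (by linarith [hut.2]))
        · rintro (rfl | hus)
          · exact ⟨hs.1, hst⟩
          · exact ⟨hus.1, hus.2.trans hst⟩
      simp only [hg]
      rw [e, ← h1 hst, add_assoc]
    · rfl
    · have e : ∑ᶠ u ∈ Ico a t, arcMult (U u) 0 = ∑ᶠ u ∈ Ico a s, arcMult (U u) 0 := by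
        refine finsum_mem_inter_support_eq' _ _ _ fun u hu =>
          ⟨fun hut => ⟨hut.1, hut.2.trans hts⟩, fun hus => ⟨hus.1, ?_⟩⟩
        by_contra! h3
        exact hu (hnear u hus.2.ne (by linarith) (by linarith [hus.2]))
      simp only [hg]
      rw [e, h2 hts]
  have := isPreconnected_Icc.constant hcont (right_mem_Icc.2 hab) (left_mem_Icc.2 hab)
  simp only [hg, Ico_self, finsum_mem_empty, add_zero] at this
  exact this

/-- Each time has a neighbourhood on which one arc works. A subdivision into equal steps shorter
than a Lebesgue number of this cover is admissible. -/
theorem exists_flowPartition {a b : ℝ} (hab : a < b) (hmem : ∀ t ∈ Icc a b, (t : ℂ) ∈ 𝒰) :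
    Nonempty (FlowPartition (fun t : ℝ => U t) a b) := by
  have hloc : ∀ x : Icc a b, ∃ ε > 0, ε < Real.pi ∧ ∀ᶠ t : ℝ in 𝓝 (x : ℝ), (t : ℂ) ∈ 𝒰 ∧
      circlePt ε ∉ spectrum ℂ (U t) ∧ circlePt (-ε) ∉ spectrum ℂ (U t) ∧
      FiniteDimensional ℂ (arcProj (U t) 0 ε).range := fun x => by
    obtain ⟨ε, h1, -, h2, -, h3⟩ := H.exists_arc (hmem x x.2) one_pos
    exact ⟨ε, h1, h2, h3⟩
  choose ε hε hεπ hgood using hloc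
  obtain ⟨δ, hδ, hleb⟩ := lebesgue_number_lemma_of_metric (isCompact_Icc (a := a) (b := b))
    (c := fun x : Icc a b => interior {t : ℝ | (t : ℂ) ∈ 𝒰 ∧
      circlePt (ε x) ∉ spectrum ℂ (U t) ∧ circlePt (-ε x) ∉ spectrum ℂ (U t) ∧
      FiniteDimensional ℂ (arcProj (U t) 0 (ε x)).range}) (fun _ => isOpen_interior)
    (fun x hx => mem_iUnion.2 ⟨⟨x, hx⟩, mem_interior_iff_mem_nhds.2 (hgood ⟨x, hx⟩)⟩)
  have hab' : 0 < b - a := sub_pos.2 hab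
  obtain ⟨n, hn⟩ := exists_nat_gt ((b - a) / δ)
  have hn0 : (0 : ℝ) < n := (div_pos hab' hδ).trans hn
  set m := (b - a) / n with hm
  have hm0 : 0 < m := div_pos hab' hn0
  have hmδ : m < δ := by
    rw [hm, div_lt_iff₀ hn0]
    rwa [div_lt_iff₀ hδ, mul_comm] at hn
  have hnm : n * m = b - a := by rw [hm]; field_simp
  have ht : ∀ i < n, a + i * m ∈ Icc a b := fun i hi => by
    have h1 : (i : ℝ) * m ≤ n * m := by gcongr
    have h2 : 0 ≤ (i : ℝ) * m := by positivity
    constructor <;> linarith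
  have hsel : ∀ i : ℕ, ∃ x : Icc a b, i < n → ball (a + i * m) δ ⊆
      interior {t : ℝ | (t : ℂ) ∈ 𝒰 ∧
        circlePt (ε x) ∉ spectrum ℂ (U t) ∧ circlePt (-ε x) ∉ spectrum ℂ (U t) ∧
        FiniteDimensional ℂ (arcProj (U t) 0 (ε x)).range} := fun i => by
    by_cases hi : i < n
    · obtain ⟨x, hx⟩ := hleb _ (ht i hi)
      exact ⟨x, fun _ => hx⟩
    -- An arbitrary value: indices from `n` on play no role.
    · exact ⟨⟨a, left_mem_Icc.2 hab.le⟩, fun h => absurd h hi⟩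
  choose x hx using hsel
  have hall : ∀ i < n, ∀ s ∈ Icc (a + i * m) (a + ((i + 1 : ℕ) : ℝ) * m), (s : ℂ) ∈ 𝒰 ∧
      circlePt (ε (x i)) ∉ spectrum ℂ (U s) ∧ circlePt (-ε (x i)) ∉ spectrum ℂ (U s) ∧
      FiniteDimensional ℂ (arcProj (U s) 0 (ε (x i))).range := fun i hi s hs => by
    push_cast at hs
    have hball : s ∈ ball (a + i * m) δ := by
      rw [mem_ball, Real.dist_eq, abs_lt]
      constructor <;> linarith [hs.1, hs.2]
    have hs' := interior_subset (hx i hi hball)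
    exact hs'
  have hfin : ∀ i < n, ∀ s ∈ Icc (a + i * m) (a + ((i + 1 : ℕ) : ℝ) * m),
      {θ ∈ Icc (-ε (x i)) (ε (x i)) | circlePt θ ∈ spectrum ℂ (U s)}.Finite ∧
      ∀ θ ∈ Icc (-ε (x i)) (ε (x i)), FiniteDimensional ℂ (eigKer (U s) (circlePt θ)) ∧
        (circlePt θ ∈ spectrum ℂ (U s) → eigKer (U s) (circlePt θ) ≠ ⊥) := fun i hi s hs => by
    obtain ⟨h1, h2, h3, h4⟩ := hall i hi s hs
    have := finite_of_finiteDimensional_arcProj (H.unitary s h1) (φ := 0) (hε (x i)) (hεπ (x i))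
    rw [zero_add, zero_sub] at this
    exact this h2 h3
  exact ⟨{
    n := n
    t := fun i => a + i * m
    ε := fun i => ε (x i)
    t_zero := by simp
    t_last := by rw [hnm]; ring
    t_lt := fun i _ => by
      push_cast
      linarith
    ε_pos := fun i _ => hε (x i)
    ε_lt := fun i _ => hεπ (x i)
    notMem_right := fun i hi s hs => (hall i hi s hs).2.1
    notMem_left := fun i hi s hs => (hall i hi s hs).2.2.1
    finite_spectrum := fun i hi s hs => (hfin i hi s hs).1
    finite_mult := fun i hi s hs θ hθ => ((hfin i hi s hs).2 θ hθ).1 }⟩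

theorem flow_eq {a b : ℝ} (hmem : ∀ t ∈ Icc a b, (t : ℂ) ∈ 𝒰)
    (P : FlowPartition (fun t : ℝ => U t) a b) :
    P.flow = -((∑ᶠ u ∈ Ico a b, arcMult (U u) 0 : ℕ) : ℤ) := by
  have hmono : ∀ j ≤ P.n, ∀ i ≤ j, P.t i ≤ P.t j := by
    intro j
    induction j with
    | zero =>
      intro _ i hi
      rw [Nat.le_zero.1 hi]
    | succ j ih =>
      intro hj i hi
      rcases Nat.le_succ_iff.1 hi with h | rfl
      · exact (ih (by omega) i h).trans (P.t_lt j (by omega)).le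
      · exact le_rfl
  have hIcc : ∀ i ≤ P.n, P.t i ∈ Icc a b := fun i hi =>
    ⟨P.t_zero.ge.trans (hmono i hi 0 (Nat.zero_le _)), (hmono P.n le_rfl i hi).trans P.t_last.le⟩
  have hfin : (Icc a b ∩ Function.support fun u : ℝ => arcMult (U u) 0).Finite := by
    refine (H.finite_setOf_eigKer_ne_bot hmem).subset fun u hu => ⟨hu.1, fun h0 => hu.2 ?_⟩
    change arcMult (U u) 0 = 0
    rw [arcMult_zero, h0, finrank_bot]
  have key : ∀ j ≤ P.n, ∑ i ∈ Finset.range j,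
      ((arcCount (U (P.t (i + 1))) (P.ε i) : ℤ) - (arcCount (U (P.t i)) (P.ε i) : ℤ))
        = -((∑ᶠ u ∈ Ico a (P.t j), arcMult (U u) 0 : ℕ) : ℤ) := by
    intro j
    induction j with
    | zero => simp [P.t_zero]
    | succ j ih =>
      intro hj
      have hj' : j < P.n := by omega
      have h1 := hIcc j hj'.le
      have h2 := hIcc (j + 1) hj
      have hlt := P.t_lt j hj'
      have hstep := H.arcCount_add_finsum hlt.le
        (fun t ht => hmem t ⟨h1.1.trans ht.1, ht.2.trans h2.2⟩) (P.ε_pos j hj') (P.ε_lt j hj')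
        ⟨P.notMem_right j hj', P.finite_spectrum j hj', P.finite_mult j hj'⟩
      have hsplit : ∑ᶠ u ∈ Ico a (P.t (j + 1)), arcMult (U u) 0
          = ∑ᶠ u ∈ Ico a (P.t j), arcMult (U u) 0
            + ∑ᶠ u ∈ Ico (P.t j) (P.t (j + 1)), arcMult (U u) 0 := by
        rw [← Ico_union_Ico_eq_Ico h1.1 hlt.le]
        refine finsum_mem_union' (Ico_disjoint_Ico_same) (hfin.subset ?_) (hfin.subset ?_)
        · exact inter_subset_inter_left _ fun u hu => ⟨hu.1, hu.2.le.trans h1.2⟩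
        · exact inter_subset_inter_left _ fun u hu => ⟨h1.1.trans hu.1, hu.2.le.trans h2.2⟩
      -- Each piece contributes minus the multiplicities on its half-open interval, whatever its
      -- `ε`; this gives independence of the choice.
      rw [Finset.sum_range_succ, ih hj'.le, hsplit, ← hstep]
      push_cast
      ring
  have := key P.n le_rfl
  rw [P.t_last] at this
  exact this

end IsClockwiseFamily

end AbstractSF

end

/-! ### The spectral flow formula -/

theorem theorem8p6 {X : Type*} [NormedAddCommGroup X] [InnerProductSpace ℂ X] [CompleteSpace X]
    (𝒰 : Set ℂ) (h𝒰 : IsOpen 𝒰) (U : ℂ → X →L[ℂ] X) (hU : AnalyticOnNhd ℂ U 𝒰)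
    (l₁ l₂ : ℝ) (hl : l₁ < l₂) (hseg : ∀ t ∈ Set.Icc l₁ l₂, (t : ℂ) ∈ 𝒰)
    (hinv₁ : IsUnit (1 + U l₁)) (hinv₂ : IsUnit (1 + U l₂))
    (hFred : ∀ z ∈ 𝒰, (1 + U z).IsFredholm)
    (hunit : ∀ t : ℝ, (t : ℂ) ∈ 𝒰 → U t ∈ unitary (X →L[ℂ] X))
    (hupper : ∀ z ∈ 𝒰, 0 < z.im → spectrum ℂ (U z) ⊆ {w | 1 < ‖w‖})
    (hlower : ∀ z ∈ 𝒰, z.im < 0 → spectrum ℂ (U z) ⊆ {w | ‖w‖ < 1}) :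
    {t ∈ Set.Ioo l₁ l₂ | LinearMap.ker ((1 + U t : X →L[ℂ] X) : X →ₗ[ℂ] X) ≠ ⊥}.Finite ∧
    (∀ t ∈ Set.Ioo l₁ l₂,
      FiniteDimensional ℂ (LinearMap.ker ((1 + U t : X →L[ℂ] X) : X →ₗ[ℂ] X))) ∧
    AbstractSF.HasSpectralFlow (fun t : ℝ => U t) l₁ l₂
      (-∑ᶠ t ∈ Set.Ioo l₁ l₂,
        (Module.finrank ℂ (LinearMap.ker ((1 + U t : X →L[ℂ] X) : X →ₗ[ℂ] X)) : ℤ)) := by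
  have H : AbstractSF.IsClockwiseFamily U 𝒰 := ⟨h𝒰, hU, hFred, hunit, hupper⟩
  have hfin := H.finite_setOf_eigKer_ne_bot hseg
  have hmult : ∀ t : ℝ, AbstractSF.arcMult (U t) 0
      = Module.finrank ℂ (LinearMap.ker ((1 + U t : X →L[ℂ] X) : X →ₗ[ℂ] X)) := fun t => by
    rw [AbstractSF.arcMult_zero, AbstractSF.eigKer_neg_one]
  simp only [← hmult]
  refine ⟨hfin.subset fun t ht => ⟨Set.Ioo_subset_Icc_self ht.1, AbstractSF.eigKer_neg_one (U t) ▸ ht.2⟩, fun t ht => ?_,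
    H.exists_flowPartition hl hseg, fun P => ?_⟩
  · exact (hFred t (hseg t (Set.Ioo_subset_Icc_self ht))).finite_ker
  · rw [H.flow_eq hseg P]
    congr 1
    have hsupp : (Set.Ioo l₁ l₂ ∩ Function.support fun u : ℝ => AbstractSF.arcMult (U u) 0).Finite := by
      refine hfin.subset fun u hu => ⟨Set.Ioo_subset_Icc_self hu.1, fun h0 => hu.2 ?_⟩
      change AbstractSF.arcMult (U u) 0 = 0
      rw [AbstractSF.arcMult_zero, h0, finrank_bot]
    -- Invertibility at `l₁` removes the only point in which the half-open interval differs from the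
    -- open one.
    have hl₁ : AbstractSF.arcMult (U l₁) 0 = 0 := by
      refine AbstractSF.arcMult_eq_zero fun hσ => AbstractSF.mem_spectrum_iff_sub.1 hσ ?_
      rwa [AbstractSF.circlePt_zero, neg_one_smul, sub_neg_eq_add, add_comm]
    have e : ∑ᶠ u ∈ Set.Ico l₁ l₂, AbstractSF.arcMult (U u) 0 = ∑ᶠ u ∈ Set.Ioo l₁ l₂, AbstractSF.arcMult (U u) 0 := by
      refine finsum_mem_inter_support_eq' _ _ _ fun u hu => ⟨fun h => ⟨?_, h.2⟩, fun h =>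
        ⟨h.1.le, h.2⟩⟩
      refine lt_of_le_of_ne h.1 ?_
      rintro rfl
      exact hu hl₁
    rw [e]
    have := (Nat.castAddMonoidHom ℤ).map_finsum_mem' hsupp
    exact this
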